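/- **Theorem.** Let $p$ be a prime, $d\ge 0$ an integer, $F$ the free pro-$p$ group on $x_1,\dots,x_d$, and $E=\mathbb F_p\langle\langle X_1,\dots,X_d\rangle\rangle$ the algebra of formal power series in noncommuting variables, filtered by the powers $E_n$ of its augmentation ideal. Let $\phi\colon F\to E^\times$ be the Magnus homomorphism, i.e. the continuous homomorphism with $\phi(x_i)=1+X_i$, and let $\mathcal E=\mathbb F_p\langle X_1,\dots,X_d\rangle=\bigoplus_n E_n/E_{n+1}$ be the algebra of noncommutative polynomials. Write $[X_i;X_j]=X_iX_j-X_jX_i$ and $[x,y]=x^{-1}y^{-1}xy$. Let $\Gamma$ be an undirected (simple) graph with vertex set $\{1,\dots,d\}$ and edge set $\mathbf E$, and let $(l_{ij})_{\{i,j\}\in\mathbf E}$ be a family of elements of $F$ indexed by the edges of $\Gamma$, where for each edge one of its two orientations $(i,j)$ is fixed. Assume that: * $\Gamma$ is the disjoint union of two graphs $\Gamma_{\mathbf A}$ and $\Gamma_{\mathbf B}$ (on disjoint sets of vertices, one of which may be empty, with no edge of $\Gamma$ between them), with edge sets $\mathbf A$ and $\mathbf B$; * $\Gamma_{\mathbf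 A}$ is bipartite, and $\phi(l_{ij})-1\equiv[X_i;X_j] \pmod{E_3}$ for every edge $\{i,j\}\in\mathbf A$; * $l_{uv}=[x_u,x_v]$ for every edge $\{u,v\}\in\mathbf B$. Let $G=F/R$, where $R$ is the closed normal subgroup of $F$ generated by the family $(l_{ij})_{\{i,j\}\in\mathbf E}$. Let $E(G)$ be the completed group algebra of $G$ over $\mathbb F_p$, let $E_n(G)$ be the $n$-th power of its augmentation ideal, and let $\mathcal E(G)=\bigoplus_{n\ge0}E_n(G)/E_{n+1}(G)$. Let $\mathcal I(\Gamma)$ be the two-sided ideal of $\mathcal E$ generated by the commutators $[X_i;X_j]$ for $\{i,j\}\in\mathbf E$, and let $\mathcal E(\Gamma)=\mathcal E/\mathcal I(\Gamma)$ be the right-angled Artin algebra of $\Gamma$. Then $\mathcal E(G)=\mathcal E(\Gamma)$. More precisely: 1. if $I$ is the closed two-sided ideal of $E$ generated by the series $\phi(l_{ij})-1$, $\{i,j\}\in\mathbf E$, then its ideal of initial forms $\mathrm{Grad}(I)=\bigoplus_n (I\cap E_n+E_{n+1})/E_{n+1}\subseteq\mathcal E$ is equal to $\mathcal I(\Gamma)$;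 2. there is an isomorphism of graded $\mathbb F_p$-algebras $\mathcal E(\Gamma)\to\mathcal E(G)$ that sends the class of $X_i$ to the class of $x_i-1$ in $E_1(G)/E_2(G)$, for $i=1,\dots,d$. -/

import Mathlib

open scoped DirectSum

noncomputable section

/-! ### Noncommutative formal power series -/

/-- The algebra `k⟨⟨X_a : a ∈ α⟩⟩` of formal power series in noncommuting variables: a series is
the family of its coefficients, indexed by the words (monomials) in the variables. -/
def NCSeries (k α : Type*) : Type _ := List α → k

set_option linter.unusedSectionVars false

namespace NCSeries

variable {k α : Type*} [CommRing k]

instance : AddCommGroup (NCSeries k α) := inferInstanceAs (AddCommGroup (List α → k))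

instance : Module k (NCSeries k α) := inferInstanceAs (Module k (List α → k))

/-- The topology of coefficientwise convergence (the coefficients being discrete). -/
instance : TopologicalSpace (NCSeries k α) :=
  @Pi.topologicalSpace (List α) (fun _ => k) (fun _ => ⊥)

/-- Product of series: the coefficient of `w` in `f * g` is the sum of `f u * g v` over all
factorizations `w = u v`. -/
instance : Mul (NCSeries k α) :=
  ⟨fun f g w => ∑ i ∈ Finset.range (w.length + 1), f (w.take i) * g (w.drop i)⟩

open Classical in
instance : One (NCSeries k α) := ⟨fun w => if w = [] then 1 else 0⟩

open Classical in
/-- The variable `X_i`. -/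
def X (i : α) : NCSeries k α := fun w => if w = [i] then 1 else 0

theorem mul_apply (f g : NCSeries k α) (w : List α) :
    (f * g) w = ∑ i ∈ Finset.range (w.length + 1), f (w.take i) * g (w.drop i) := rfl

@[simp] theorem add_apply (f g : NCSeries k α) (w : List α) : (f + g) w = f w + g w := rfl

@[simp] theorem zero_apply (w : List α) : (0 : NCSeries k α) w = 0 := rfl

@[simp] theorem neg_apply (f : NCSeries k α) (w : List α) : (-f) w = -f w := rfl

@[simp] theorem smul_apply (c : k) (f : NCSeries k α) (w : List α) : (c • f) w = c * f w := rfl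

@[simp] theorem one_nil : (1 : NCSeries k α) [] = 1 := by
  change (if _ then _ else _) = _
  simp

@[simp] theorem one_cons (a : α) (w : List α) : (1 : NCSeries k α) (a :: w) = 0 := by
  change (if _ then _ else _) = _
  simp

@[simp] theorem mul_nil (f g : NCSeries k α) : (f * g) [] = f [] * g [] := by
  simp [mul_apply]

/-- The series `w ↦ f (a w)`. -/
def shift (a : α) (f : NCSeries k α) : NCSeries k α := fun w => f (a :: w)

@[simp] theorem shift_apply (a : α) (f : NCSeries k α) (w : List α) : shift a f w = f (a :: w) :=
  rfl

theorem mul_cons (f g : NCSeries k α) (a : α) (w : List α) :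
    (f * g) (a :: w) = f [] * g (a :: w) + (shift a f * g) w := by
  rw [mul_apply, mul_apply, List.length_cons, Finset.sum_range_succ', add_comm]
  rfl

protected theorem add_mul' (f g h : NCSeries k α) : (f + g) * h = f * h + g * h := by
  funext w
  simp [mul_apply, add_mul, Finset.sum_add_distrib]

protected theorem mul_add' (f g h : NCSeries k α) : f * (g + h) = f * g + f * h := by
  funext w
  simp [mul_apply, mul_add, Finset.sum_add_distrib]

protected theorem smul_mul' (c : k) (f g : NCSeries k α) : (c • f) * g = c • (f * g) := by
  funext w
  simp [mul_apply, mul_assoc, Finset.mul_sum]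

protected theorem mul_smul' (c : k) (f g : NCSeries k α) : f * (c • g) = c • (f * g) := by
  funext w
  simp only [mul_apply, smul_apply, Finset.mul_sum]
  exact Finset.sum_congr rfl fun _ _ => by ring

protected theorem zero_mul' (f : NCSeries k α) : 0 * f = 0 := by
  funext w
  simp [mul_apply]

protected theorem mul_zero' (f : NCSeries k α) : f * 0 = 0 := by
  funext w
  simp [mul_apply]

protected theorem one_mul' (f : NCSeries k α) : 1 * f = f := by
  funext w
  cases w with
  | nil => simp
  | cons a w =>
    have h : shift a (1 : NCSeries k α) = 0 := by
      funext v
      simp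
    rw [mul_cons, h, NCSeries.zero_mul']
    simp

protected theorem mul_one' (f : NCSeries k α) : f * 1 = f := by
  funext w
  induction w generalizing f with
  | nil => simp
  | cons a w ih =>
    rw [mul_cons, ih]
    simp

protected theorem mul_assoc' (f g h : NCSeries k α) : f * g * h = f * (g * h) := by
  funext w
  induction w generalizing f with
  | nil => simp [mul_assoc]
  | cons a w ih =>
    have e : shift a (f * g) = f [] • shift a g + shift a f * g := by
      funext v
      simp [mul_cons]
    rw [mul_cons, mul_cons, mul_cons, e, NCSeries.add_mul', NCSeries.smul_mul', add_apply, ih]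
    simp only [mul_nil, smul_apply]
    ring

instance : Ring (NCSeries k α) :=
  { (inferInstance : AddCommGroup (NCSeries k α)) with
    mul := (· * ·)
    one := 1
    mul_assoc := NCSeries.mul_assoc'
    one_mul := NCSeries.one_mul'
    mul_one := NCSeries.mul_one'
    left_distrib := NCSeries.mul_add'
    right_distrib := NCSeries.add_mul'
    zero_mul := NCSeries.zero_mul'
    mul_zero := NCSeries.mul_zero' }

instance : Algebra k (NCSeries k α) :=
  Algebra.ofModule NCSeries.smul_mul' NCSeries.mul_smul'

/-- The augmentation of `k⟨⟨X⟩⟩`: the constant coefficient. -/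
def aug (k α : Type*) [CommRing k] : NCSeries k α →ₐ[k] k :=
  AlgHom.ofLinearMap
    { toFun := fun f => f []
      map_add' := fun _ _ => rfl
      map_smul' := fun _ _ => rfl }
    one_nil mul_nil

/-- A noncommutative polynomial viewed as a series. -/
def ofPoly (k α : Type*) [CommRing k] : FreeAlgebra k α →ₐ[k] NCSeries k α :=
  FreeAlgebra.lift k X

open Classical in
/-- The series `1 - X_i + X_i ^ 2 - ⋯`. -/
def invOneAddX (i : α) : NCSeries k α := fun w => if ∀ a ∈ w, a = i then (-1) ^ w.length else 0

theorem shift_one_add_X (i a : α) [Decidable (a = i)] :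
    shift a (1 + X i : NCSeries k α) = if a = i then 1 else 0 := by
  funext w
  cases w with
  | nil => by_cases h : a = i <;> simp [X, h]
  | cons b w => by_cases h : a = i <;> simp [X, h]

theorem shift_invOneAddX (i a : α) [Decidable (a = i)] :
    shift a (invOneAddX i : NCSeries k α) = if a = i then -invOneAddX i else 0 := by
  funext w
  by_cases h : a = i
  · subst h
    by_cases h' : ∀ b ∈ w, b = a
    · have h2 : ∀ b ∈ a :: w, b = a := List.forall_mem_cons.mpr ⟨rfl, h'⟩
      rw [if_pos rfl, neg_apply, shift_apply, invOneAddX, invOneAddX, if_pos h2, if_pos h',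
        List.length_cons, pow_succ, mul_neg_one]
    · have h2 : ¬ ∀ b ∈ a :: w, b = a := fun h => h' (List.forall_mem_cons.mp h).2
      rw [if_pos rfl, neg_apply, shift_apply, invOneAddX, invOneAddX, if_neg h2, if_neg h',
        neg_zero]
  · simp [invOneAddX, h]

theorem one_add_X_mul_inv (i : α) : (1 + X i : NCSeries k α) * invOneAddX i = 1 := by
  classical
  funext w
  cases w with
  | nil => simp [X, invOneAddX]
  | cons a w =>
    rw [mul_cons, shift_one_add_X]
    have h2 := congrFun (shift_invOneAddX (k := k) i a) w
    rw [shift_apply] at h2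
    rw [h2]
    by_cases h : a = i <;> simp [X, h]

theorem inv_mul_one_add_X (i : α) : invOneAddX i * (1 + X i : NCSeries k α) = 1 := by
  classical
  funext w
  induction w with
  | nil => simp [X, invOneAddX]
  | cons a w ih =>
    rw [mul_cons, shift_invOneAddX]
    have h2 := congrFun (shift_one_add_X (k := k) i a) w
    rw [shift_apply] at h2
    rw [h2]
    by_cases h : a = i
    · simp only [h, if_true, neg_mul, neg_apply, ih]
      simp [invOneAddX]
    · simp [h]

/-- The Magnus homomorphism on the abstract free group, `x_i ↦ 1 + X_i`. -/
def magnusFree (k α : Type*) [CommRing k] : FreeGroup α →* (NCSeries k α)ˣ :=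
  FreeGroup.lift fun i =>
    ⟨1 + X i, invOneAddX i, one_add_X_mul_inv i, inv_mul_one_add_X i⟩

/-- The series `f` and `g` have the same coefficients in all degrees `< n`. -/
def Agree (n : ℕ) (f g : NCSeries k α) : Prop := ∀ w : List α, w.length < n → f w = g w

theorem Agree.mul {n : ℕ} {f f' g g' : NCSeries k α} (hf : Agree n f f') (hg : Agree n g g') :
    Agree n (f * g) (f' * g') := by
  intro w hw
  rw [mul_apply, mul_apply]
  refine Finset.sum_congr rfl fun i _ => ?_
  rw [hf _ (by rw [List.length_take]; omega), hg _ (by rw [List.length_drop]; omega)]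

theorem Agree.refl (n : ℕ) (f : NCSeries k α) : Agree n f f := fun _ _ => rfl

/-- The elements `g` of the free group whose Magnus series is `1 + (terms of degree ≥ n)`. -/
def magnusKer (k α : Type*) [CommRing k] (n : ℕ) : Subgroup (FreeGroup α) where
  carrier := {g | Agree n (magnusFree k α g : NCSeries k α) 1}
  one_mem' := by
    intro w _
    rw [map_one, Units.val_one]
  mul_mem' := by
    intro a b ha hb
    have h := Agree.mul ha hb
    simpa using h
  inv_mem' := by
    intro a ha
    have h := (Agree.refl n ((magnusFree k α a)⁻¹ : (NCSeries k α)ˣ).val).mul ha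
    simp only [Units.inv_mul, mul_one] at h
    intro w hw
    rw [map_inv]
    exact (h w hw).symm

instance (n : ℕ) : (magnusKer k α n).Normal := by
  refine ⟨fun a ha g => ?_⟩
  have h := ((Agree.refl n (magnusFree k α g).val).mul ha).mul
    (Agree.refl n ((magnusFree k α g)⁻¹ : (NCSeries k α)ˣ).val)
  simp only [mul_one, Units.mul_inv] at h
  change Agree n _ _
  simpa using h

theorem agree_of_mem {n : ℕ} {a b : FreeGroup α} (h : a⁻¹ * b ∈ magnusKer k α n) :
    Agree n (magnusFree k α a : NCSeries k α) (magnusFree k α b) := by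
  have h1 := (Agree.refl n (magnusFree k α a).val).mul h
  simp only [map_mul, map_inv, Units.val_mul, Units.mul_inv_cancel_left, mul_one] at h1
  exact fun w hw => (h1 w hw).symm

theorem mem_of_agree {n : ℕ} {a b : FreeGroup α}
    (h : Agree n (magnusFree k α a : NCSeries k α) (magnusFree k α b)) :
    a⁻¹ * b ∈ magnusKer k α n := by
  have h1 := (Agree.refl n ((magnusFree k α a)⁻¹ : (NCSeries k α)ˣ).val).mul h
  simp only [Units.inv_mul] at h1
  change Agree n _ _
  simp only [map_mul, map_inv, Units.val_mul]
  exact fun w hw => (h1 w hw).symm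

instance (n : ℕ) [Finite α] [Finite k] : Finite (FreeGroup α ⧸ magnusKer k α n) := by
  have : Finite {w : List α // w.length < n} := (List.finite_length_lt α n).to_subtype
  let φ : FreeGroup α ⧸ magnusKer k α n → ({w : List α // w.length < n} → k) :=
    fun q w => (magnusFree k α q.out : NCSeries k α) w.1
  refine Finite.of_injective φ fun q r h => ?_
  rw [← QuotientGroup.out_eq' q, ← QuotientGroup.out_eq' r, QuotientGroup.eq]
  exact mem_of_agree fun w hw => congrFun h ⟨w, hw⟩

theorem aug_magnusFree (g : FreeGroup α) : (magnusFree k α g : NCSeries k α) [] = 1 := by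
  have h : (Units.map (aug k α : NCSeries k α →* k)).comp (magnusFree k α) = 1 := by
    refine FreeGroup.ext_hom _ _ fun i => ?_
    ext
    rw [MonoidHom.comp_apply, magnusFree, FreeGroup.lift_apply_of]
    change (1 + X i : NCSeries k α) [] = 1
    simp [X]
  exact congrArg Units.val (DFunLike.congr_fun h g)

theorem pow_agree {y : NCSeries k α} (hy : y [] = 0) (n : ℕ) : Agree n (y ^ n) 0 := by
  induction n with
  | zero => exact fun w hw => absurd hw (Nat.not_lt_zero _)
  | succ n ih =>
    intro w hw
    rw [pow_succ']
    cases w with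
    | nil => simp [hy]
    | cons a w =>
      rw [mul_cons, hy, zero_mul, zero_add,
        ((Agree.refl n (shift a y)).mul ih) w (by simpa using hw), mul_zero]
      rfl

theorem isPGroup_quotient_magnusKer (p : ℕ) [Fact p.Prime] (n : ℕ) :
    IsPGroup p (FreeGroup α ⧸ magnusKer (ZMod p) α n) := by
  have hinj : Function.Injective (algebraMap (ZMod p) (NCSeries (ZMod p) α)) := by
    intro a b h
    have h' := congrArg (aug (ZMod p) α) h
    simpa using h'
  have : CharP (NCSeries (ZMod p) α) p := charP_of_injective_algebraMap hinj p
  intro q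
  refine ⟨n, ?_⟩
  obtain ⟨g, rfl⟩ := QuotientGroup.mk_surjective q
  rw [← QuotientGroup.mk_pow, QuotientGroup.eq_one_iff]
  change Agree n _ _
  have hn : n ≤ p ^ n := (Nat.lt_pow_self (Fact.out : p.Prime).one_lt).le
  set u : NCSeries (ZMod p) α := (magnusFree (ZMod p) α g).val with hu
  have h0 : (u - 1) [] = 0 := by
    rw [sub_eq_add_neg, add_apply, neg_apply, one_nil, hu, aug_magnusFree]
    ring
  have h1 : u ^ p ^ n = (u - 1) ^ p ^ n + 1 := by
    conv_lhs => rw [← sub_add_cancel u 1]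
    rw [add_pow_char_pow_of_commute p n (Commute.one_right _), one_pow]
  rw [map_pow, Units.val_pow_eq_pow_val, h1]
  intro w hw
  rw [add_apply, pow_agree h0 (p ^ n) w (hw.trans_le hn), zero_apply, zero_add]

end NCSeries

/-! ### Free pro-`p` groups -/

/-- A normal subgroup of `H` whose quotient is a finite `p`-group. -/
structure PKernel (p : ℕ) (H : Type*) [Group H] where
  /-- the underlying subgroup -/
  sub : Subgroup H
  normal : sub.Normal
  finite : Finite (H ⧸ sub)
  isPGroup : letI := normal; IsPGroup p (H ⧸ sub)

namespace PKernel

variable {p : ℕ} {H : Type*} [Group H]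

instance (N : PKernel p H) : N.sub.Normal := N.normal

/-- The finite `p`-group `H / N`, with the discrete topology. -/
def Quot (N : PKernel p H) : Type _ := H ⧸ N.sub

instance (N : PKernel p H) : Group N.Quot := inferInstanceAs (Group (H ⧸ N.sub))

instance (N : PKernel p H) : TopologicalSpace N.Quot := ⊥

instance (N : PKernel p H) : DiscreteTopology N.Quot := ⟨rfl⟩

/-- The projection `H → H / N`. -/
def proj (N : PKernel p H) : H →* N.Quot := QuotientGroup.mk' N.sub

/-- The transition map `H / N → H / M` for `N ≤ M`. -/
def trans {N M : PKernel p H} (h : N.sub ≤ M.sub) : N.Quot →* M.Quot :=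
  QuotientGroup.map N.sub M.sub (MonoidHom.id H) h

end PKernel

/-- The pro-`p` completion of `H`: the inverse limit of the finite quotients of `H` that are
`p`-groups, inside the product of these finite discrete groups. -/
def proPCompletion (p : ℕ) (H : Type*) [Group H] : Subgroup (∀ N : PKernel p H, N.Quot) where
  carrier := {f | ∀ (N M : PKernel p H) (h : N.sub ≤ M.sub), PKernel.trans h (f N) = f M}
  one_mem' := fun _ _ _ => map_one _
  mul_mem' := fun {f g} hf hg N M h => by
    rw [Pi.mul_apply, Pi.mul_apply, map_mul, hf N M h, hg N M h]
  inv_mem' := fun {f} hf N M h => by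
    rw [Pi.inv_apply, Pi.inv_apply, map_inv, hf N M h]

/-- The free pro-`p` group on `x_1, …, x_d`: the pro-`p` completion of the abstract free group. -/
abbrev FreeProP (p d : ℕ) : Type := proPCompletion p (FreeGroup (Fin d))

namespace FreeProP

variable {p d : ℕ}

/-- The canonical map from the abstract free group. -/
def ofFree (p d : ℕ) : FreeGroup (Fin d) →* FreeProP p d where
  toFun g := ⟨fun N => N.proj g, fun _ _ _ => rfl⟩
  map_one' := rfl
  map_mul' _ _ := rfl

/-- The free generator `x_i`. -/
def x (i : Fin d) : FreeProP p d := ofFree p d (FreeGroup.of i)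

variable [Fact p.Prime]

/-- The kernel of the Magnus homomorphism modulo terms of degree `≥ n`. -/
def level (p d : ℕ) [Fact p.Prime] (n : ℕ) : PKernel p (FreeGroup (Fin d)) where
  sub := NCSeries.magnusKer (ZMod p) (Fin d) n
  normal := inferInstance
  finite := inferInstance
  isPGroup := NCSeries.isPGroup_quotient_magnusKer p n

/-- A word in the generators that has the same image as `f` in the `n`-th level. -/
def approx (f : FreeProP p d) (n : ℕ) : FreeGroup (Fin d) :=
  Quotient.out (s := QuotientGroup.leftRel (level p d n).sub) (f.1 (level p d n))

theorem mk_approx (f : FreeProP p d) (n : ℕ) :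
    (level p d n).proj (approx f n) = f.1 (level p d n) :=
  QuotientGroup.out_eq' (s := (level p d n).sub) _

theorem level_le {m n : ℕ} (h : m ≤ n) : (level p d n).sub ≤ (level p d m).sub :=
  fun _ hg w hw => hg w (hw.trans_le h)

/-- The coefficients of the Magnus series, computed with the approximation at the level given by
the degree of the monomial. -/
def magnusFun (f : FreeProP p d) : NCSeries (ZMod p) (Fin d) := fun w =>
  (NCSeries.magnusFree (ZMod p) (Fin d) (approx f (w.length + 1)) :
    NCSeries (ZMod p) (Fin d)) w

theorem agree_magnusFun {f : FreeProP p d} {n : ℕ} {g : FreeGroup (Fin d)}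
    (h : (level p d n).proj g = f.1 (level p d n)) :
    NCSeries.Agree n (magnusFun f)
      (NCSeries.magnusFree (ZMod p) (Fin d) g : NCSeries (ZMod p) (Fin d)) := by
  intro w hw
  have hle : (level p d n).sub ≤ (level p d (w.length + 1)).sub := level_le hw
  have h1 : (level p d (w.length + 1)).proj g = (level p d (w.length + 1)).proj
      (approx f (w.length + 1)) := by
    rw [mk_approx, ← f.2 _ _ hle, ← h]
    rfl
  exact (NCSeries.agree_of_mem (QuotientGroup.eq.mp h1) w (Nat.lt_succ_self _)).symm

/-- The Magnus homomorphism `φ` on the free pro-`p` group, with values in `𝔽_p⟨⟨X⟩⟩`: the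
continuous homomorphism with `x_i ↦ 1 + X_i`. -/
def magnus (p d : ℕ) [Fact p.Prime] : FreeProP p d →* NCSeries (ZMod p) (Fin d) where
  toFun := magnusFun
  map_one' := by
    funext w
    have h := agree_magnusFun (f := (1 : FreeProP p d)) (n := w.length + 1) (g := 1) rfl w
      (Nat.lt_succ_self _)
    simpa using h
  map_mul' f g := by
    funext w
    have h := agree_magnusFun (f := f * g) (n := w.length + 1)
      (g := approx f (w.length + 1) * approx g (w.length + 1))
      (by rw [map_mul, mk_approx, mk_approx]; rfl) w (Nat.lt_succ_self _)
    rw [h, map_mul, Units.val_mul]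
    exact (NCSeries.Agree.mul (agree_magnusFun (mk_approx f _))
      (agree_magnusFun (mk_approx g _)) w (Nat.lt_succ_self _)).symm

theorem magnus_x (i : Fin d) : magnus p d (x i) = 1 + NCSeries.X i := by
  funext w
  refine (agree_magnusFun (f := x i) (n := w.length + 1) (g := FreeGroup.of i) rfl w
    (Nat.lt_succ_self _)).trans ?_
  simp [NCSeries.magnusFree]

theorem continuous_magnus : Continuous (magnus p d) := by
  let _ : TopologicalSpace (ZMod p) := ⊥
  refine continuous_pi fun w => ?_
  have h : Continuous fun f : FreeProP p d => f.1 (level p d (w.length + 1)) :=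
    (continuous_apply _).comp continuous_subtype_val
  exact (continuous_of_discreteTopology (f := fun q : (level p d (w.length + 1)).Quot =>
    (NCSeries.magnusFree (ZMod p) (Fin d) (Quotient.out
      (s := QuotientGroup.leftRel (level p d (w.length + 1)).sub) q) :
        NCSeries (ZMod p) (Fin d)) w)).comp h

end FreeProP

/-! ### The filtration of an augmented algebra and its graded algebra -/

section Graded

variable {k A : Type*} [CommRing k] [Ring A] [Algebra k A] (ε : A →ₐ[k] k)

/-- The `n`-th power of the augmentation ideal. -/
def augPow (n : ℕ) : Submodule k A := (RingHom.ker ε ^ n : Ideal A).restrictScalars k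

theorem augPow_zero : augPow ε 0 = ⊤ := by
  rw [augPow, Submodule.pow_zero, Ideal.one_eq_top]
  rfl

theorem augPow_one : augPow ε 1 = (RingHom.ker ε).restrictScalars k := by
  rw [augPow, Submodule.pow_one]

theorem augPow_anti {m n : ℕ} (h : m ≤ n) : augPow ε n ≤ augPow ε m :=
  fun _ hx => Ideal.pow_le_pow_right (I := RingHom.ker ε) h hx

theorem augPow_mul {m n : ℕ} {a b : A} (ha : a ∈ augPow ε m) (hb : b ∈ augPow ε n) :
    a * b ∈ augPow ε (m + n) := by
  change a * b ∈ (RingHom.ker ε ^ (m + n) : Ideal A)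
  rw [Ideal.IsTwoSided.pow_add]
  exact Ideal.mul_mem_mul ha hb

/-- The degree `n` part `A_n / A_{n+1}` of the graded algebra, where `A_n` is the `n`-th power of
the augmentation ideal. -/
def GrPart (n : ℕ) : Type _ := augPow ε n ⧸ (augPow ε (n + 1)).submoduleOf (augPow ε n)

namespace GrPart

instance (n : ℕ) : AddCommGroup (GrPart ε n) :=
  inferInstanceAs (AddCommGroup (augPow ε n ⧸ (augPow ε (n + 1)).submoduleOf (augPow ε n)))

instance (n : ℕ) : Module k (GrPart ε n) :=
  inferInstanceAs (Module k (augPow ε n ⧸ (augPow ε (n + 1)).submoduleOf (augPow ε n)))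

variable {ε}

/-- The class in `A_n / A_{n+1}` of an element of `A_n`. -/
def mk {n : ℕ} : augPow ε n →ₗ[k] GrPart ε n :=
  Submodule.mkQ ((augPow ε (n + 1)).submoduleOf (augPow ε n))

theorem mk_surjective {n : ℕ} : Function.Surjective (mk : augPow ε n →ₗ[k] GrPart ε n) :=
  Submodule.mkQ_surjective _

theorem mk_eq_mk {n : ℕ} {a b : augPow ε n} :
    mk a = mk b ↔ (a : A) - b ∈ augPow ε (n + 1) :=
  Submodule.Quotient.eq _

/-- The product `A_m / A_{m+1} × A_n / A_{n+1} → A_{m+n} / A_{m+n+1}` induced by that of `A`. -/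
def mul {m n : ℕ} (x : GrPart ε m) (y : GrPart ε n) : GrPart ε (m + n) :=
  Quotient.map₂ (fun a b : _ => (⟨a.1 * b.1, augPow_mul ε a.2 b.2⟩ : augPow ε (m + n)))
    (by
      intro a a' ha b b' hb
      rw [← Quotient.eq_iff_equiv] at ha hb ⊢
      have ha' : (a : A) - a' ∈ augPow ε (m + 1) := mk_eq_mk.mp ha
      have hb' : (b : A) - b' ∈ augPow ε (n + 1) := mk_eq_mk.mp hb
      refine mk_eq_mk.mpr ?_
      have e : (a : A) * b - a' * b' = (a - a') * b + a' * (b - b') := by noncomm_ring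
      change (a : A) * b - a' * b' ∈ _
      rw [e]
      have h1 := augPow_mul ε ha' b.2
      have h2 := augPow_mul ε a'.2 hb'
      rw [add_right_comm] at h1
      exact add_mem h1 h2) x y

theorem mul_mk {m n : ℕ} (a : augPow ε m) (b : augPow ε n) :
    mul (mk a) (mk b) = mk ⟨a.1 * b.1, augPow_mul ε a.2 b.2⟩ := rfl

theorem sigma_eq {m n : ℕ} {a : augPow ε m} {b : augPow ε n} (h : m = n) (hab : (a : A) = b) :
    GradedMonoid.mk (A := GrPart ε) m (mk a) = GradedMonoid.mk n (mk b) := by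
  subst h
  rw [Subtype.ext hab]

instance : GradedMonoid.GOne (GrPart ε) :=
  ⟨mk ⟨1, by rw [augPow_zero]; trivial⟩⟩

instance : GradedMonoid.GMul (GrPart ε) := ⟨mul⟩

instance : DirectSum.GRing (GrPart ε) where
  mul_zero a := by
    obtain ⟨a, rfl⟩ := mk_surjective a
    rw [← map_zero mk]
    exact (mul_mk a 0).trans (congrArg mk (Subtype.ext (mul_zero _)))
  zero_mul b := by
    obtain ⟨b, rfl⟩ := mk_surjective b
    rw [← map_zero mk]
    exact (mul_mk 0 b).trans (congrArg mk (Subtype.ext (zero_mul _)))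
  mul_add a b c := by
    obtain ⟨a, rfl⟩ := mk_surjective a
    obtain ⟨b, rfl⟩ := mk_surjective b
    obtain ⟨c, rfl⟩ := mk_surjective c
    exact congrArg mk (Subtype.ext (mul_add _ _ _))
  add_mul a b c := by
    obtain ⟨a, rfl⟩ := mk_surjective a
    obtain ⟨b, rfl⟩ := mk_surjective b
    obtain ⟨c, rfl⟩ := mk_surjective c
    exact congrArg mk (Subtype.ext (add_mul _ _ _))
  one_mul := by
    rintro ⟨n, a⟩
    obtain ⟨a, rfl⟩ := mk_surjective a
    exact sigma_eq (zero_add n) (one_mul _)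
  mul_one := by
    rintro ⟨n, a⟩
    obtain ⟨a, rfl⟩ := mk_surjective a
    exact sigma_eq (add_zero n) (mul_one _)
  mul_assoc := by
    rintro ⟨m, a⟩ ⟨n, b⟩ ⟨r, c⟩
    obtain ⟨a, rfl⟩ := mk_surjective a
    obtain ⟨b, rfl⟩ := mk_surjective b
    obtain ⟨c, rfl⟩ := mk_surjective c
    exact sigma_eq (add_assoc m n r) (mul_assoc _ _ _)
  natCast n := mk ⟨n, by rw [augPow_zero]; trivial⟩
  natCast_zero := by
    rw [← map_zero mk]
    exact congrArg mk (Subtype.ext Nat.cast_zero)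
  natCast_succ n := congrArg mk (Subtype.ext (Nat.cast_succ n))
  intCast n := mk ⟨n, by rw [augPow_zero]; trivial⟩
  intCast_ofNat n := congrArg mk (Subtype.ext (Int.cast_natCast n))
  intCast_negSucc_ofNat n := congrArg mk (Subtype.ext (Int.cast_negSucc n))

instance : DirectSum.GAlgebra k (GrPart ε) where
  toFun := mk.toAddMonoidHom.comp
    { toFun := fun r => ⟨algebraMap k A r, by rw [augPow_zero]; trivial⟩
      map_zero' := Subtype.ext (map_zero _)
      map_add' := fun _ _ => Subtype.ext (map_add _ _ _) }
  map_one := congrArg mk (Subtype.ext (map_one _))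
  map_mul r s := sigma_eq (zero_add 0).symm (map_mul _ _ _)
  commutes := by
    rintro r ⟨n, a⟩
    obtain ⟨a, rfl⟩ := mk_surjective a
    exact sigma_eq (add_comm 0 n) (Algebra.commutes r _)
  smul_def := by
    rintro r ⟨n, a⟩
    obtain ⟨a, rfl⟩ := mk_surjective a
    exact sigma_eq (a := r • a) (zero_add n).symm (Algebra.smul_def r _)

end GrPart

/-- The graded algebra `⨁ A_n / A_{n+1}` of the augmented algebra `A`, filtered by the powers of
its augmentation ideal. -/
abbrev GradedAlg : Type _ := ⨁ n, GrPart ε n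

end Graded

/-! ### The completed group algebra -/

section CompletedGroupAlgebra

variable (p : ℕ) (G : Type*) [Group G] [TopologicalSpace G]

/-- The completed group algebra `𝔽_p⟦G⟧`: the inverse limit of the group algebras `𝔽_p[G / U]`
over the open normal subgroups `U` of `G`. -/
def completedGroupAlgebra :
    Subalgebra (ZMod p) (∀ U : OpenNormalSubgroup G, MonoidAlgebra (ZMod p) (G ⧸ U.toSubgroup)) where
  carrier := {e | ∀ (U V : OpenNormalSubgroup G) (h : U.toSubgroup ≤ V.toSubgroup),
    MonoidAlgebra.mapDomainAlgHom (ZMod p) (ZMod p)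
      (QuotientGroup.map U.toSubgroup V.toSubgroup (MonoidHom.id G) h) (e U) = e V}
  mul_mem' := fun {e f} he hf U V h => by
    rw [Pi.mul_apply, Pi.mul_apply, map_mul, he U V h, hf U V h]
  add_mem' := fun {e f} he hf U V h => by
    rw [Pi.add_apply, Pi.add_apply, map_add, he U V h, hf U V h]
  algebraMap_mem' := fun r U V h => AlgHom.commutes _ r

variable {G} in
/-- The group element `g` in the completed group algebra. -/
def groupElt (g : G) : completedGroupAlgebra p G :=
  ⟨fun U => MonoidAlgebra.of (ZMod p) (G ⧸ U.toSubgroup) g, fun U V h => by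
    simp only [MonoidAlgebra.of_apply, MonoidAlgebra.mapDomainAlgHom_apply,
      MonoidAlgebra.mapDomain_single]
    rfl⟩

/-- The whole group as an open normal subgroup. -/
def wholeGroup : OpenNormalSubgroup G where
  toOpenSubgroup := ⊤
  isNormal' := inferInstanceAs (⊤ : Subgroup G).Normal

/-- The augmentation of the completed group algebra, `g ↦ 1` for `g ∈ G`: the sum of the
coefficients at any finite level. -/
def groupAug : completedGroupAlgebra p G →ₐ[ZMod p] ZMod p :=
  (MonoidAlgebra.lift (ZMod p) (ZMod p) (G ⧸ (wholeGroup G).toSubgroup) 1).comp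
    ((Pi.evalAlgHom (ZMod p) _ (wholeGroup G)).comp (completedGroupAlgebra p G).val)

theorem groupAug_groupElt (g : G) : groupAug p G (groupElt p g) = 1 := by
  simp [groupAug, groupElt]

/-- The graded algebra `𝓔(G)` of the completed group algebra of `G`. -/
abbrev GradedGroupAlgebra : Type _ := GradedAlg (groupAug p G)

variable {G} in
/-- The class of `g - 1` in the degree one part of `𝓔(G)`. -/
def groupSymbol (g : G) : GradedGroupAlgebra p G :=
  DirectSum.lof (ZMod p) ℕ (GrPart (groupAug p G)) 1
    (GrPart.mk ⟨groupElt p g - 1, by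
      rw [augPow_one]
      change groupAug p G (groupElt p g - 1) = 0
      rw [map_sub, groupAug_groupElt, map_one, sub_self]⟩)

end CompletedGroupAlgebra

/-! ### Right-angled Artin algebras -/

section RAAA

variable (k : Type*) [CommRing k] {V : Type*} (Γ : SimpleGraph V)

/-- The two-sided ideal `𝓘(Γ)` of `k⟨X⟩` generated by the commutators `X_i X_j - X_j X_i` for
the edges `{i, j}` of `Γ`. -/
def raaIdeal : TwoSidedIdeal (FreeAlgebra k V) :=
  TwoSidedIdeal.span {q | ∃ i j, Γ.Adj i j ∧
    q = FreeAlgebra.ι k i * FreeAlgebra.ι k j - FreeAlgebra.ι k j * FreeAlgebra.ι k i}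

/-- The right-angled Artin algebra `𝓔(Γ) = k⟨X⟩ / 𝓘(Γ)`. -/
abbrev RAAAlgebra : Type _ := (raaIdeal k Γ).ringCon.Quotient

/-- The image of the variable `X_i` in `𝓔(Γ)`. -/
def raaX (i : V) : RAAAlgebra k Γ := (raaIdeal k Γ).ringCon.mkₐ k (FreeAlgebra.ι k i)

/-- The degree `n` part of `𝓔(Γ)`, spanned by the monomials of length `n`. -/
def raaDegree (n : ℕ) : Submodule k (RAAAlgebra k Γ) :=
  Submodule.span k (Set.range (raaX k Γ)) ^ n

end RAAA

/-! ### Presentations -/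

section Presentation

variable {p d : ℕ}

/-- `π : F → G` and the family `l` form a presentation of the topological group `G` as a quotient
of the free pro-`p` group `F`: `π` is a continuous surjection whose kernel is the closed normal
subgroup generated by `l`. -/
structure IsProPPresentation {ι G : Type*} [Group G] [TopologicalSpace G]
    (π : FreeProP p d →* G) (l : ι → FreeProP p d) : Prop where
  continuous : Continuous π
  surjective : Function.Surjective π
  ker_eq : (π.ker : Set (FreeProP p d)) = closure (Subgroup.normalClosure (Set.range l))

variable [Fact p.Prime]

/-- The series `w = φ(l - 1)` attached to a relation `l`. -/
def relSeries (l : FreeProP p d) : NCSeries (ZMod p) (Fin d) := FreeProP.magnus p d l - 1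

/-- The closed two-sided ideal `I` of `𝔽_p⟨⟨X⟩⟩` generated by the series `φ(l_i - 1)`. -/
def relIdeal {ι : Type*} (l : ι → FreeProP p d) : Set (NCSeries (ZMod p) (Fin d)) :=
  closure (TwoSidedIdeal.span (Set.range fun i => relSeries (l i)) :
    Set (NCSeries (ZMod p) (Fin d)))

/-- `Grad(I) = ⨁ (I ∩ E_n + E_{n+1}) / E_{n+1}` as a subset of the polynomial algebra `𝔽_p⟨X⟩`,
where `E_n` is the `n`-th power of the augmentation ideal of `𝔽_p⟨⟨X⟩⟩`: the polynomials each of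
whose homogeneous components, of degree `n` say, is the degree `n` component of an element
of `I ∩ E_n`. -/
def gradIdeal (I : Set (NCSeries (ZMod p) (Fin d))) : Set (FreeAlgebra (ZMod p) (Fin d)) :=
  {q | ∀ n : ℕ, ∃ f ∈ I, f ∈ augPow (NCSeries.aug (ZMod p) (Fin d)) n ∧
    ∀ w : List (Fin d), w.length = n → f w = NCSeries.ofPoly (ZMod p) (Fin d) q w}

/-- The condition on a graph `Γ` with vertices `1, …, d` and on a family `l` of elements of the free
pro-`p` group indexed by the edges of `Γ`: `Γ` is a disjoint union of a bipartite graph `Γ_A`, the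
subgraph on a set `S` of vertices, and a graph `Γ_B`, the subgraph on the complement of `S`;
`φ(l_{ij} - 1) ≡ [X_i; X_j]` modulo `E_3` for the edges `{i, j}` of `Γ_A`; and
`l_{uv} = x_u⁻¹ x_v⁻¹ x_u x_v` for the edges `{u, v}` of `Γ_B`. Each edge may be given either of its
two orientations. -/
def GradCondition (Γ : SimpleGraph (Fin d)) (l : Γ.edgeSet → FreeProP p d) : Prop :=
  ∃ S : Set (Fin d),
    (∀ i j, Γ.Adj i j → (i ∈ S ↔ j ∈ S)) ∧
    (Γ.induce S).IsBipartite ∧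
    (∀ e : Γ.edgeSet, (∀ v ∈ e.1, v ∈ S) → ∃ i j, e.1 = s(i, j) ∧
      relSeries (l e) - (NCSeries.X i * NCSeries.X j - NCSeries.X j * NCSeries.X i) ∈
        augPow (NCSeries.aug (ZMod p) (Fin d)) 3) ∧
    (∀ e : Γ.edgeSet, (∀ v ∈ e.1, v ∉ S) → ∃ u v, e.1 = s(u, v) ∧
      l e = (FreeProP.x u)⁻¹ * (FreeProP.x v)⁻¹ * FreeProP.x u * FreeProP.x v)

end Presentation

end

/-! Multiplying a relator series by a sign or by a unit makes it start with the commutator of its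
edge, so `𝓘(Γ) ⊆ Grad(I)`. The content is that no further initial forms occur.

Let `L_v` be left multiplication by `X_v` on `M = 𝓔(Γ)`, and suppose that operators `T_v = t L_v +
O(t²)` in `End(M)[t]` satisfy the given relations modulo `t^(n+3)`. Substituting `X_v ↦ T_v` kills
`I` modulo `t^(n+3)`. For `f ∈ I` of order at least `n`, with degree `n` part `f_n`, the coefficient
of `t^n` then gives `f_n(L) = 0`, and applying this to `1 ∈ M` gives `f_n ∈ 𝓘(Γ)`
(`trunc_mem_raaIdeal`).

The `T_v` are built degree by degree (`exists_deformation`). Let `U`, `W` be the colour classes of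
`Γ_A`. Only `T_i` with `i ∈ U` is ever corrected; otherwise `T_j = t L_j`. For an edge from `i ∈ U`
to `j ∈ W`, adding `t^(s+2) D_i` to `T_i` changes `[T_i, T_j]` by `t^(s+3) [D_i, L_j]`, and the
terms of degree at least 3 in the relation only by a multiple of `t^(s+4)`. So one needs `D_i` with
prescribed commutators with `L_j` for the neighbours `j ∈ W` of `i`, an independent set. The
relators of `Γ_B` are exact unit multiples of commutators (`relSeries_commutator`) and avoid `U`, so
they need no correction.

Commutators are prescribed in `exists_commutator_eq`. Let `∂_j` strip a leading `X_j`. On an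
independent set `∂_i (X_j m) = δ_ij m`, so the recursion `D m = ∑ (P_j + X_j D) (∂_j m)` solves `D
X_j - X_j D = P_j`. It terminates because enough `∂_j` kill any given element.

Finally `X_i ↦ x_i - 1` defines a map from `E` to `E(G)`, because the augmentation ideal of `𝔽_p[P]`
is nilpotent for a finite `p`-group `P`. It is onto by compactness and its kernel is `I`
(`mem_of_evalGroup_eq_zero`), so the graded algebra of `E(G)` is `𝓔 / Grad(I)`. -/

namespace NCSeries

/-! ### Monomials, and agreement of series up to a given degree -/

variable {k α : Type*} [CommRing k]

open Classical in
theorem shift_X (a b : α) : shift b (X a : NCSeries k α) = if b = a then 1 else 0 := by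
  funext w
  cases w with
  | nil => by_cases h : b = a <;> simp [X, h]
  | cons c w => by_cases h : b = a <;> simp [X, h]

@[simp] theorem X_nil (a : α) : (X a : NCSeries k α) [] = 0 := by
  simp [X]

theorem X_mul_nil (a : α) (f : NCSeries k α) : (X a * f : NCSeries k α) [] = 0 := by
  simp

open Classical in
theorem X_mul_cons (a b : α) (f : NCSeries k α) (w : List α) :
    (X a * f : NCSeries k α) (b :: w) = if b = a then f w else 0 := by
  rw [mul_cons, shift_X]
  by_cases h : b = a <;> simp [h]

theorem sum_apply {ι : Type*} (s : Finset ι) (f : ι → NCSeries k α) (w : List α) :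
    (∑ i ∈ s, f i) w = ∑ i ∈ s, f i w :=
  Finset.sum_apply w s f

@[simp] theorem sub_apply (f g : NCSeries k α) (w : List α) : (f - g) w = f w - g w := rfl

/-- The monomial of a word, as a noncommutative polynomial. -/
def word (k : Type*) [CommRing k] (w : List α) : FreeAlgebra k α :=
  (w.map (FreeAlgebra.ι k)).prod

theorem word_cons (a : α) (w : List α) : word k (a :: w) = FreeAlgebra.ι k a * word k w := by
  simp [word]

theorem word_append (u v : List α) : word k (u ++ v) = word k u * word k v := by
  simp [word]

theorem lift_word {A : Type*} [Ring A] [Algebra k A] (a : α → A) (w : List α) :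
    FreeAlgebra.lift k a (word k w) = (w.map a).prod := by
  simp [word, map_list_prod, Function.comp_def]

@[simp] theorem ofPoly_ι (a : α) : ofPoly k α (FreeAlgebra.ι k a) = X a := by
  simp [ofPoly]

open Classical in
theorem ofPoly_word (w v : List α) : ofPoly k α (word k w) v = if v = w then 1 else 0 := by
  induction w generalizing v with
  | nil => cases v <;> simp [word]
  | cons a w ih =>
    rw [word_cons, map_mul, ofPoly_ι]
    cases v with
    | nil => simp
    | cons b v =>
      rw [X_mul_cons, ih]
      by_cases h : b = a <;> simp [h]

theorem span_word : Submodule.span k (Set.range (word k : List α → FreeAlgebra k α)) = ⊤ := by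
  rw [eq_top_iff]
  intro q _
  induction q using FreeAlgebra.induction with
  | grade0 r =>
    rw [Algebra.algebraMap_eq_smul_one]
    exact Submodule.smul_mem _ _ (Submodule.subset_span ⟨[], rfl⟩)
  | grade1 a => exact Submodule.subset_span ⟨[a], by simp [word]⟩
  | add a b ha hb => exact add_mem (ha trivial) (hb trivial)
  | mul a b ha hb =>
    have := Submodule.mul_mem_mul (ha trivial) (hb trivial)
    rw [Submodule.span_mul_span] at this
    refine Submodule.span_mono ?_ this
    rintro _ ⟨_, ⟨u, rfl⟩, _, ⟨v, rfl⟩, rfl⟩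
    exact ⟨u ++ v, word_append u v⟩

section Agree

set_option linter.unusedSectionVars false

theorem Agree.add {n : ℕ} {f f' g g' : NCSeries k α} (hf : Agree n f f') (hg : Agree n g g') :
    Agree n (f + g) (f' + g') := fun w hw => by
  rw [add_apply, add_apply, hf w hw, hg w hw]

theorem Agree.symm {n : ℕ} {f g : NCSeries k α} (h : Agree n f g) : Agree n g f :=
  fun w hw => (h w hw).symm

theorem Agree.trans {n : ℕ} {f g h : NCSeries k α} (h₁ : Agree n f g) (h₂ : Agree n g h) :
    Agree n f h :=
  fun w hw => (h₁ w hw).trans (h₂ w hw)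

theorem Agree.mono {m n : ℕ} {f g : NCSeries k α} (h : Agree n f g) (hmn : m ≤ n) :
    Agree m f g :=
  fun w hw => h w (hw.trans_le hmn)

theorem agree_sub_zero {n : ℕ} {f g : NCSeries k α} : Agree n (f - g) 0 ↔ Agree n f g := by
  simp [Agree, sub_eq_zero]

theorem Agree.mul_of_zero {m n : ℕ} {f g : NCSeries k α} (hf : Agree m f 0) (hg : Agree n g 0) :
    Agree (m + n) (f * g) 0 := by
  intro w hw
  rw [mul_apply, zero_apply]
  refine Finset.sum_eq_zero fun i hi => ?_
  rw [Finset.mem_range] at hi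
  by_cases h : i < m
  · rw [hf _ (by rw [List.length_take]; omega), zero_apply, zero_mul]
  · rw [hg _ (by rw [List.length_drop]; omega), zero_apply, mul_zero]

end Agree

/-! ### Truncation, and evaluation of series at nilpotent families -/

section Trunc

variable [Finite α]

variable (k α) in
/-- The truncation of a series to degrees `< n`. -/
noncomputable def trunc (n : ℕ) : NCSeries k α →ₗ[k] FreeAlgebra k α where
  toFun f := ∑ w ∈ (List.finite_length_lt α n).toFinset, f w • word k w
  map_add' f g := by simp [add_smul, Finset.sum_add_distrib]
  map_smul' c f := by simp [mul_smul, Finset.smul_sum]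

theorem trunc_apply (n : ℕ) (f : NCSeries k α) :
    trunc k α n f = ∑ w ∈ (List.finite_length_lt α n).toFinset, f w • word k w := rfl

theorem ofPoly_trunc (n : ℕ) (f : NCSeries k α) (v : List α) :
    ofPoly k α (trunc k α n f) v = if v.length < n then f v else 0 := by
  classical
  simp only [trunc_apply, map_sum, map_smul, sum_apply, smul_apply, ofPoly_word, mul_ite, mul_one,
    mul_zero]
  refine (Finset.sum_ite_eq _ v fun i => f i).trans ?_
  simp

theorem agree_ofPoly_trunc (n : ℕ) (f : NCSeries k α) :
    Agree n (ofPoly k α (trunc k α n f)) f := fun w hw => by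
  rw [ofPoly_trunc, if_pos hw]

theorem trunc_congr {n : ℕ} {f g : NCSeries k α} (h : Agree n f g) :
    trunc k α n f = trunc k α n g := by
  rw [trunc_apply, trunc_apply]
  refine Finset.sum_congr rfl fun w hw => ?_
  rw [h w (by simpa using hw)]

theorem exists_trunc_ofPoly (q : FreeAlgebra k α) :
    ∃ N, ∀ n ≥ N, trunc k α n (ofPoly k α q) = q := by
  classical
  have hq : q ∈ Submodule.span k (Set.range (word k : List α → FreeAlgebra k α)) := by
    rw [span_word]; trivial
  induction hq using Submodule.span_induction with
  | mem _ h =>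
    obtain ⟨w, rfl⟩ := h
    refine ⟨w.length + 1, fun n hn => ?_⟩
    rw [trunc_apply, Finset.sum_eq_single w]
    · simp [ofPoly_word]
    · intro v _ hv
      simp [ofPoly_word, hv]
    · intro h
      simp at h
      omega
  | zero => exact ⟨0, fun n _ => by simp⟩
  | add a b _ _ ha hb =>
    obtain ⟨m, hm⟩ := ha
    obtain ⟨n, hn⟩ := hb
    refine ⟨max m n, fun N hN => ?_⟩
    rw [map_add, map_add, hm N (le_of_max_le_left hN), hn N (le_of_max_le_right hN)]
  | smul c a _ ha =>
    obtain ⟨m, hm⟩ := ha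
    exact ⟨m, fun N hN => by rw [map_smul, map_smul, hm N hN]⟩

theorem mem_span_word_of_agree {n : ℕ} {q : FreeAlgebra k α} (h : Agree n (ofPoly k α q) 0) :
    q ∈ Submodule.span k (word k '' {w : List α | n ≤ w.length}) := by
  obtain ⟨N, hN⟩ := exists_trunc_ofPoly q
  rw [← hN N le_rfl, trunc_apply]
  refine sum_mem fun w _ => ?_
  by_cases hw : w.length < n
  · rw [h w hw, zero_apply, zero_smul]
    exact zero_mem _
  · exact Submodule.smul_mem _ _ (Submodule.subset_span ⟨w, not_lt.mp hw, rfl⟩)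

/-- Polynomials of order at least `n` are spanned by words of length at least `n`. Estimates for a
substitution `X_v ↦ T_v` are thereby reduced to monomials. -/
theorem map_mem_of_agree {M : Type*} [AddCommGroup M] [Module k M] {n : ℕ}
    {q : FreeAlgebra k α} (h : Agree n (ofPoly k α q) 0) (φ : FreeAlgebra k α →ₗ[k] M)
    (S : Submodule k M) (hS : ∀ w : List α, n ≤ w.length → φ (word k w) ∈ S) : φ q ∈ S := by
  have : Submodule.span k (word k '' {w : List α | n ≤ w.length}) ≤ S.comap φ := by
    rw [Submodule.span_le]
    rintro _ ⟨w, hw, rfl⟩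
    exact hS w hw
  exact this (mem_span_word_of_agree h)

variable {A : Type*} [Ring A] [Algebra k A]

theorem lift_eq_zero_of_agree {a : α → A} {n : ℕ}
    (ha : ∀ w : List α, n ≤ w.length → (w.map a).prod = 0) {q : FreeAlgebra k α}
    (h : Agree n (ofPoly k α q) 0) : FreeAlgebra.lift k a q = 0 :=
  map_mem_of_agree h (FreeAlgebra.lift k a).toLinearMap ⊥ fun w hw => by
    simpa [lift_word] using ha w hw

theorem lift_congr_of_agree {a : α → A} {n : ℕ}
    (ha : ∀ w : List α, n ≤ w.length → (w.map a).prod = 0) {q r : FreeAlgebra k α}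
    (h : Agree n (ofPoly k α q) (ofPoly k α r)) :
    FreeAlgebra.lift k a q = FreeAlgebra.lift k a r := by
  rw [← sub_eq_zero, ← map_sub]
  exact lift_eq_zero_of_agree ha (by rwa [map_sub, agree_sub_zero])

/-- Evaluation of series at a family for which all monomials of large degree vanish. -/
noncomputable def evalNil (a : α → A) (n : ℕ)
    (ha : ∀ w : List α, n ≤ w.length → (w.map a).prod = 0) : NCSeries k α →ₐ[k] A :=
  AlgHom.ofLinearMap ((FreeAlgebra.lift k a).toLinearMap ∘ₗ trunc k α n)
    (by
      change FreeAlgebra.lift k a (trunc k α n 1) = 1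
      rw [← map_one (FreeAlgebra.lift k a)]
      refine lift_congr_of_agree ha ?_
      rw [map_one (ofPoly k α)]
      exact agree_ofPoly_trunc n 1)
    (fun f g => by
      change FreeAlgebra.lift k a (trunc k α n (f * g)) =
        FreeAlgebra.lift k a (trunc k α n f) * FreeAlgebra.lift k a (trunc k α n g)
      rw [← map_mul]
      refine lift_congr_of_agree ha ?_
      rw [map_mul (ofPoly k α)]
      -- Truncation is not multiplicative, but the discrepancy lies in degrees at least `n`, which
      -- the family kills.
      exact (agree_ofPoly_trunc n _).trans
        ((agree_ofPoly_trunc n f).mul (agree_ofPoly_trunc n g)).symm)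

theorem evalNil_apply (a : α → A) (n : ℕ)
    (ha : ∀ w : List α, n ≤ w.length → (w.map a).prod = 0) (f : NCSeries k α) :
    evalNil a n ha f = FreeAlgebra.lift k a (trunc k α n f) := rfl

theorem evalNil_congr (a : α → A) (n : ℕ)
    (ha : ∀ w : List α, n ≤ w.length → (w.map a).prod = 0) {f g : NCSeries k α}
    (h : Agree n f g) : evalNil a n ha f = evalNil a n ha g := by
  rw [evalNil_apply, evalNil_apply, trunc_congr h]

theorem evalNil_ofPoly (a : α → A) (n : ℕ)
    (ha : ∀ w : List α, n ≤ w.length → (w.map a).prod = 0) (q : FreeAlgebra k α) :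
    evalNil a n ha (ofPoly k α q) = FreeAlgebra.lift k a q :=
  lift_congr_of_agree ha (agree_ofPoly_trunc n _)

theorem evalNil_X (a : α → A) (n : ℕ)
    (ha : ∀ w : List α, n ≤ w.length → (w.map a).prod = 0) (i : α) :
    evalNil a n ha (X i : NCSeries k α) = a i := by
  rw [← ofPoly_ι (k := k), evalNil_ofPoly, FreeAlgebra.lift_ι_apply]

end Trunc

/-! ### Powers of the augmentation ideal as orders of vanishing -/

section AugPow

theorem agree_of_mem_augPow {n : ℕ} {f : NCSeries k α} (hf : f ∈ augPow (aug k α) n) :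
    Agree n f 0 := by
  induction n generalizing f with
  | zero => exact fun w hw => absurd hw (Nat.not_lt_zero _)
  | succ n ih =>
    change f ∈ (RingHom.ker (aug k α) ^ (n + 1) : Ideal _) at hf
    rw [Ideal.IsTwoSided.pow_succ] at hf
    refine Submodule.mul_induction_on hf (fun a ha b hb => ?_) (fun a b ha hb => ?_)
    · have h1 : Agree 1 a 0 := by
        intro w hw
        rw [List.length_eq_zero_iff.mp (Nat.lt_one_iff.mp hw)]
        exact ha
      have := h1.mul_of_zero (ih hb)
      rwa [add_comm] at this
    · simpa using ha.add hb

theorem X_mem_augPow (i : α) : (X i : NCSeries k α) ∈ augPow (aug k α) 1 := by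
  rw [augPow_one]
  change (X i : NCSeries k α) [] = 0
  simp [X]

theorem eq_sum_X_mul_shift [Fintype α] {f : NCSeries k α} (hf : f [] = 0) :
    f = ∑ a, X a * shift a f := by
  classical
  funext w
  rw [sum_apply]
  cases w with
  | nil => simp [hf]
  | cons b w =>
    simp only [X_mul_cons]
    rw [Finset.sum_ite_eq, if_pos (Finset.mem_univ _), shift_apply]

/-- With finitely many variables, a series without constant term is the finite sum of `X a * shift a
f`, and each shift has order one less. -/
theorem mem_augPow_iff [Finite α] {n : ℕ} {f : NCSeries k α} :
    f ∈ augPow (aug k α) n ↔ Agree n f 0 := by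
  have := Fintype.ofFinite α
  refine ⟨agree_of_mem_augPow, fun h => ?_⟩
  induction n generalizing f with
  | zero => rw [augPow_zero]; trivial
  | succ n ih =>
    rw [eq_sum_X_mul_shift (h [] (Nat.succ_pos n))]
    refine sum_mem fun a _ => ?_
    rw [add_comm]
    exact augPow_mul _ (X_mem_augPow a) (ih fun w hw => h (a :: w) (by simpa using hw))

end AugPow

end NCSeries

/-! ### The right-angled Artin algebra and its multiplication operators -/

section RightAngledArtin

variable {k : Type*} [CommRing k] {V : Type*} {Γ : SimpleGraph V}

theorem raaX_mul_comm {i j : V} (h : Γ.Adj i j) :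
    raaX k Γ i * raaX k Γ j = raaX k Γ j * raaX k Γ i := by
  rw [raaX, raaX, ← map_mul, ← map_mul, RingCon.mkₐ_apply, RingCon.mkₐ_apply, RingCon.eq,
    TwoSidedIdeal.rel_iff]
  exact TwoSidedIdeal.subset_span ⟨i, j, h, rfl⟩

theorem mk_raaIdeal_eq_zero {q : FreeAlgebra k V} :
    (raaIdeal k Γ).ringCon.mkₐ k q = 0 ↔ q ∈ raaIdeal k Γ := by
  rw [← map_zero ((raaIdeal k Γ).ringCon.mkₐ k), RingCon.mkₐ_apply, RingCon.mkₐ_apply, RingCon.eq,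
    TwoSidedIdeal.rel_iff, sub_zero]

/-- The algebra homomorphism out of `𝓔(Γ)` with prescribed values on the variables. -/
noncomputable def raaLift {B : Type*} [Ring B] [Algebra k B] (b : V → B)
    (hb : ∀ i j, Γ.Adj i j → b i * b j = b j * b i) : RAAAlgebra k Γ →ₐ[k] B :=
  (raaIdeal k Γ).ringCon.liftₐ (FreeAlgebra.lift k b) (by
    have h : raaIdeal k Γ ≤ TwoSidedIdeal.ker (FreeAlgebra.lift k b) := by
      rw [raaIdeal, TwoSidedIdeal.span_le]
      rintro _ ⟨i, j, hij, rfl⟩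
      simp [TwoSidedIdeal.mem_ker, hb i j hij]
    intro x y hxy
    have hxy' := h ((TwoSidedIdeal.rel_iff _ _ _).mp hxy)
    rw [TwoSidedIdeal.mem_ker, map_sub, sub_eq_zero] at hxy'
    exact hxy')

theorem raaLift_raaX {B : Type*} [Ring B] [Algebra k B] (b : V → B)
    (hb : ∀ i j, Γ.Adj i j → b i * b j = b j * b i) (i : V) :
    raaLift b hb (raaX k Γ i) = b i :=
  FreeAlgebra.lift_ι_apply b i

/-- Induction principle: the algebra is spanned by the images of words, which are built by left
multiplication by variables. -/
theorem raa_eq_top {S : Submodule k (RAAAlgebra k Γ)} (h1 : 1 ∈ S)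
    (hX : ∀ i, ∀ m ∈ S, raaX k Γ i * m ∈ S) : S = ⊤ := by
  rw [eq_top_iff]
  intro m _
  obtain ⟨q, rfl⟩ := RingCon.mkₐ_surjective (α := k) (raaIdeal k Γ).ringCon m
  have h : (⊤ : Submodule k (FreeAlgebra k V)) ≤
      S.comap ((raaIdeal k Γ).ringCon.mkₐ k).toLinearMap := by
    rw [← NCSeries.span_word, Submodule.span_le]
    rintro _ ⟨w, rfl⟩
    induction w with
    | nil => simpa [NCSeries.word] using h1
    | cons i w ih =>
      change (raaIdeal k Γ).ringCon.mkₐ k _ ∈ S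
      rw [NCSeries.word_cons, map_mul]
      exact hX i _ ih
  exact h trivial

/-- Left multiplication by the variable `X_i`. -/
noncomputable def raaMulX (k : Type*) [CommRing k] {V : Type*} (Γ : SimpleGraph V) (i : V) :
    Module.End k (RAAAlgebra k Γ) :=
  LinearMap.mulLeft k (raaX k Γ i)

@[simp] theorem raaMulX_apply (i : V) (m : RAAAlgebra k Γ) :
    raaMulX k Γ i m = raaX k Γ i * m := rfl

theorem raaMulX_mul_comm {i j : V} (h : Γ.Adj i j) :
    raaMulX k Γ i * raaMulX k Γ j = raaMulX k Γ j * raaMulX k Γ i := by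
  ext m
  simp only [Module.End.mul_apply, raaMulX_apply]
  rw [← mul_assoc, ← mul_assoc, raaX_mul_comm h]

/-- The regular representation is faithful, as evaluation at `1` shows. This turns the vanishing of
an operator into membership in `raaIdeal`. -/
theorem lift_raaMulX_apply_one (q : FreeAlgebra k V) :
    FreeAlgebra.lift k (raaMulX k Γ) q 1 = (raaIdeal k Γ).ringCon.mkₐ k q := by
  have h : FreeAlgebra.lift k (raaMulX k Γ) =
      (Algebra.lmul k (RAAAlgebra k Γ)).comp ((raaIdeal k Γ).ringCon.mkₐ k) := by
    refine FreeAlgebra.hom_ext (funext fun i => ?_)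
    ext m
    simp [raaX]
  rw [h]
  simp

/-! ### Stripping operators and the solution of commutator equations -/

section Partial

open Classical in
/-- The action of `X_i` on pairs `(m, ∂ m)`, where `∂` strips a leading variable `X_j`. -/
noncomputable def raaPair (k : Type*) [CommRing k] {V : Type*} (Γ : SimpleGraph V) (j i : V) :
    Module.End k (RAAAlgebra k Γ × RAAAlgebra k Γ) :=
  LinearMap.prod (raaMulX k Γ i ∘ₗ LinearMap.fst k _ _)
    ((if i = j then LinearMap.fst k _ _ else 0) +
      (if Γ.Adj i j then raaMulX k Γ i ∘ₗ LinearMap.snd k _ _ else 0))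

open Classical in
theorem raaPair_apply (j i : V) (a b : RAAAlgebra k Γ) :
    raaPair k Γ j i (a, b) =
      (raaX k Γ i * a, (if i = j then a else 0) + (if Γ.Adj i j then raaX k Γ i * b else 0)) := by
  refine Prod.ext rfl ?_
  change (_ + _ : RAAAlgebra k Γ × RAAAlgebra k Γ →ₗ[k] RAAAlgebra k Γ) (a, b) = _
  rw [LinearMap.add_apply]
  congr 1 <;> split_ifs <;> rfl

/-- This makes `∂_j` well defined on the quotient algebra. The delicate case is `u = j` (or `v =
j`): stripping `X_j` before or after passing the adjacent `X_v` leaves `X_v a` both times. -/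
theorem raaPair_mul_comm (j u v : V) (h : Γ.Adj u v) :
    raaPair k Γ j u * raaPair k Γ j v = raaPair k Γ j v * raaPair k Γ j u := by
  classical
  refine LinearMap.ext fun ⟨a, b⟩ => ?_
  simp only [Module.End.mul_apply, raaPair_apply]
  refine Prod.ext ?_ ?_
  · simp only
    rw [← mul_assoc, raaX_mul_comm h, mul_assoc]
  · have hc : raaX k Γ u * (raaX k Γ v * b) = raaX k Γ v * (raaX k Γ u * b) := by
      rw [← mul_assoc, raaX_mul_comm h, mul_assoc]
    simp only
    by_cases hu : u = j
    · subst hu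
      simp [h.ne', h.symm]
    · by_cases hv : v = j
      · subst hv
        simp [h.ne, h]
      · simp only [hu, hv, if_false, zero_add]
        split_ifs <;> simp [hc]

/-- The linear map that strips a leading variable `X_j` from a monomial, and vanishes on monomials
that do not begin with `X_j`. -/
noncomputable def raaPartial (k : Type*) [CommRing k] {V : Type*} (Γ : SimpleGraph V) (j : V) :
    Module.End k (RAAAlgebra k Γ) :=
  LinearMap.snd k _ _ ∘ₗ LinearMap.applyₗ ((1, 0) : RAAAlgebra k Γ × RAAAlgebra k Γ) ∘ₗ
    (raaLift (raaPair k Γ j) (raaPair_mul_comm j)).toLinearMap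

theorem raaPartial_one (j : V) : raaPartial k Γ j 1 = 0 := by
  simp [raaPartial]

-- A leading `X_j` may sit behind `X_i` exactly when `X_i` commutes with it. In particular the
-- second term is absent when `i` and `j` are not adjacent, and in that case `∂_j (X_i m)` is `m` or
-- `0`.
open Classical in
theorem raaPartial_X_mul (j i : V) (m : RAAAlgebra k Γ) :
    raaPartial k Γ j (raaX k Γ i * m) =
      (if i = j then m else 0) + (if Γ.Adj i j then raaX k Γ i * raaPartial k Γ j m else 0) := by
  set Ψ := raaLift (k := k) (raaPair k Γ j) (raaPair_mul_comm j) with hΨ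
  have hmul : ∀ i m, Ψ (raaX k Γ i * m) (1, 0) = raaPair k Γ j i (Ψ m (1, 0)) := fun i m => by
    rw [map_mul, hΨ, raaLift_raaX]
    rfl
  -- On first coordinates `Ψ` is the regular representation, so the orbit of `(1, 0)` carries `m`
  -- next to `∂_j m`.
  have hfst : ∀ m, (Ψ m (1, 0)).1 = m := by
    have h := raa_eq_top (Γ := Γ) (S := LinearMap.eqLocus
      (LinearMap.fst k _ _ ∘ₗ LinearMap.applyₗ ((1, 0) : RAAAlgebra k Γ × RAAAlgebra k Γ) ∘ₗ
        Ψ.toLinearMap) LinearMap.id) (by simp) (fun i m hm => by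
          change (Ψ (raaX k Γ i * m) (1, 0)).1 = raaX k Γ i * m
          rw [hmul]
          change raaX k Γ i * (Ψ m (1, 0)).1 = raaX k Γ i * m
          exact congrArg _ hm)
    intro m
    have : m ∈ (⊤ : Submodule k (RAAAlgebra k Γ)) := trivial
    rw [← h] at this
    exact this
  change (Ψ (raaX k Γ i * m) (1, 0)).2 = _ + (if _ then _ * (Ψ m (1, 0)).2 else 0)
  have h2 : Ψ m (1, 0) = (m, (Ψ m (1, 0)).2) := Prod.ext (hfst m) rfl
  rw [hmul, h2, raaPair_apply]

/-- The elements that are killed by all products of `n` of the maps `∂_j` with `j ∈ N`. -/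
noncomputable def raaFil (k : Type*) [CommRing k] {V : Type*} (Γ : SimpleGraph V) (N : Finset V) :
    ℕ → Submodule k (RAAAlgebra k Γ)
  | 0 => ⊥
  | n + 1 => ⨅ j ∈ N, (raaFil k Γ N n).comap (raaPartial k Γ j)

theorem mem_raaFil_succ {N : Finset V} {n : ℕ} {m : RAAAlgebra k Γ} :
    m ∈ raaFil k Γ N (n + 1) ↔ ∀ j ∈ N, raaPartial k Γ j m ∈ raaFil k Γ N n := by
  simp [raaFil]

theorem raaFil_mono (N : Finset V) : Monotone (raaFil k Γ N) := by
  refine monotone_nat_of_le_succ fun n => ?_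
  induction n with
  | zero => exact bot_le
  | succ n ih =>
    intro m hm
    rw [mem_raaFil_succ] at hm ⊢
    exact fun j hj => ih (hm j hj)

theorem X_mul_mem_raaFil {N : Finset V} (i : V) {n : ℕ} {m : RAAAlgebra k Γ}
    (hm : m ∈ raaFil k Γ N n) : raaX k Γ i * m ∈ raaFil k Γ N (n + 1) := by
  classical
  induction n generalizing m with
  | zero =>
    obtain rfl : m = 0 := hm
    rw [mul_zero]
    exact zero_mem _
  | succ n ih =>
    rw [mem_raaFil_succ]
    intro j hj
    rw [raaPartial_X_mul]
    refine add_mem ?_ ?_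
    · split_ifs
      exacts [hm, zero_mem _]
    · split_ifs
      exacts [ih (mem_raaFil_succ.mp hm j hj), zero_mem _]

/-- Local nilpotence of the family `∂_j`: the element `1` has level 1 and multiplication by a
variable raises the level by at most one. This is what stops the recursion for `D`. -/
theorem exists_mem_raaFil (N : Finset V) (m : RAAAlgebra k Γ) : ∃ n, m ∈ raaFil k Γ N n := by
  have h : (⨆ n, raaFil k Γ N n) = ⊤ := by
    refine raa_eq_top ?_ ?_
    · refine Submodule.mem_iSup_of_mem 1 ?_
      rw [mem_raaFil_succ]
      intro j _
      rw [raaPartial_one]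
      exact zero_mem _
    · intro i m hm
      rw [Submodule.mem_iSup_of_directed _ (raaFil_mono N).directed_le] at hm
      obtain ⟨n, hn⟩ := hm
      exact Submodule.mem_iSup_of_mem (n + 1) (X_mul_mem_raaFil i hn)
  rw [← Submodule.mem_iSup_of_directed _ (raaFil_mono N).directed_le, h]
  trivial

/-- Successive approximations to the solution of `Δ X_j - X_j Δ = P_j`, `j ∈ N`. -/
noncomputable def commutatorApprox (N : Finset V) (P : V → Module.End k (RAAAlgebra k Γ)) :
    ℕ → Module.End k (RAAAlgebra k Γ)
  | 0 => 0
  | n + 1 => ∑ j ∈ N, (P j + raaMulX k Γ j * commutatorApprox N P n) * raaPartial k Γ j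

theorem commutatorApprox_succ_apply (N : Finset V) (P : V → Module.End k (RAAAlgebra k Γ)) (n : ℕ)
    (m : RAAAlgebra k Γ) : commutatorApprox N P (n + 1) m =
      ∑ j ∈ N, (P j (raaPartial k Γ j m) +
        raaX k Γ j * commutatorApprox N P n (raaPartial k Γ j m)) := by
  simp [commutatorApprox, LinearMap.sum_apply]

/-- Each unfolding of the recursion applies one more `∂_j`, so on level `n` the unfoldings after the
`n`-th are evaluated at zero. -/
theorem commutatorApprox_eq (N : Finset V) (P : V → Module.End k (RAAAlgebra k Γ)) {n a : ℕ}
    (h : n ≤ a) {m : RAAAlgebra k Γ} (hm : m ∈ raaFil k Γ N n) :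
    commutatorApprox N P a m = commutatorApprox N P n m := by
  induction n generalizing a m with
  | zero =>
    obtain rfl : m = 0 := hm
    simp
  | succ n ih =>
    obtain ⟨a, rfl⟩ := Nat.exists_eq_add_of_le' h
    rw [← add_assoc, commutatorApprox_succ_apply, commutatorApprox_succ_apply]
    refine Finset.sum_congr rfl fun j hj => ?_
    rw [ih (Nat.le_add_left n a) (mem_raaFil_succ.mp hm j hj)]

/-- Over an independent set of vertices, commutators with the variables can be prescribed. -/
theorem exists_commutator_eq (N : Finset V) (hN : ∀ i ∈ N, ∀ j ∈ N, ¬ Γ.Adj i j)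
    (P : V → Module.End k (RAAAlgebra k Γ)) :
    ∃ D : Module.End k (RAAAlgebra k Γ), ∀ j ∈ N,
      D * raaMulX k Γ j - raaMulX k Γ j * D = P j := by
  classical
  choose c hc using exists_mem_raaFil (k := k) (Γ := Γ) N
  have key : ∀ {n m}, m ∈ raaFil k Γ N n →
      commutatorApprox N P (c m) m = commutatorApprox N P n m := fun {n m} hm => by
    rcases le_total n (c m) with h | h
    · exact commutatorApprox_eq N P h hm
    · exact (commutatorApprox_eq N P h (hc m)).symm
  -- The pointwise stable value of the approximations. Linearity holds because any two elements
  -- share a level at which both values are already stable.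
  let D : Module.End k (RAAAlgebra k Γ) :=
    { toFun := fun m => commutatorApprox N P (c m) m
      map_add' := fun a b => by
        have ha := raaFil_mono N (le_max_left (c a) (c b)) (hc a)
        have hb := raaFil_mono N (le_max_right (c a) (c b)) (hc b)
        rw [key (add_mem ha hb), key ha, key hb, map_add]
      map_smul' := fun r a => by
        rw [key (Submodule.smul_mem _ r (hc a)), map_smul]
        rfl }
  have hD : ∀ {n m}, m ∈ raaFil k Γ N n → D m = commutatorApprox N P n m := key
  refine ⟨D, fun j hj => ?_⟩
  ext m
  -- By independence `∂_i (X_j m) = δ_ij m` for `i, j ∈ N`, so only the summand `P_j m + X_j D m` of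
  -- `D (X_j m)` survives.
  rw [LinearMap.sub_apply, Module.End.mul_apply, Module.End.mul_apply, raaMulX_apply,
    raaMulX_apply, hD (X_mul_mem_raaFil j (hc m)), hD (hc m), commutatorApprox_succ_apply,
    Finset.sum_eq_single_of_mem j hj]
  · rw [raaPartial_X_mul, if_pos rfl, if_neg (hN j hj j hj), add_zero, add_sub_cancel_right]
  · intro i hi hij
    rw [raaPartial_X_mul, if_neg hij.symm, if_neg (hN j hj i hi), add_zero, map_zero, map_zero,
      mul_zero, add_zero]

end Partial

end RightAngledArtin

/-! ### Divisibility by powers of the central variable over a noncommutative ring -/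

section XAdic

open Polynomial

variable {A : Type*} [Ring A]

theorem Polynomial.X_pow_add_dvd_mul {m n : ℕ} {a b : A[X]} (ha : X ^ m ∣ a) (hb : X ^ n ∣ b) :
    X ^ (m + n) ∣ a * b := by
  obtain ⟨c, rfl⟩ := ha
  obtain ⟨d, rfl⟩ := hb
  refine ⟨c * d, ?_⟩
  rw [pow_add, mul_assoc, ← mul_assoc c, ← X_pow_mul (n := n) (p := c)]
  simp only [mul_assoc]

/-- The ideal of polynomials divisible by `X ^ n`, over a ring that need not be commutative. -/
noncomputable def xPowIdeal (A : Type*) [Ring A] (n : ℕ) : TwoSidedIdeal A[X] :=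
  TwoSidedIdeal.mk' {f | X ^ n ∣ f} (dvd_zero _) dvd_add (fun h => (dvd_neg).mpr h)
    (fun {x y} h => by simpa using X_pow_add_dvd_mul (m := 0) (by simp) h)
    (fun h => Dvd.dvd.mul_right h _)

theorem mem_xPowIdeal {n : ℕ} {f : A[X]} : f ∈ xPowIdeal A n ↔ X ^ n ∣ f :=
  TwoSidedIdeal.mem_mk' _ _ _ _ _ _ _

theorem X_pow_length_dvd {α : Type*} {T : α → A[X]} (hT : ∀ v, X ∣ T v) (w : List α) :
    X ^ w.length ∣ (w.map T).prod := by
  induction w with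
  | nil => simp
  | cons a w ih =>
    rw [List.map_cons, List.prod_cons, List.length_cons, add_comm]
    exact X_pow_add_dvd_mul (by simpa using hT a) ih

/-- Factors are replaced one at a time: the replaced one contributes `X ^ s`, and each of the
`w.length` others contributes `X`. -/
theorem X_pow_dvd_prod_sub {α : Type*} {T T' : α → A[X]} {s : ℕ} (hT : ∀ v, X ∣ T v)
    (hT' : ∀ v, X ∣ T' v) (h : ∀ v, X ^ s ∣ T' v - T v) (a : α) (w : List α) :
    X ^ (s + w.length) ∣ ((a :: w).map T').prod - ((a :: w).map T).prod := by
  induction w generalizing a with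
  | nil => simpa using h a
  | cons b w ih =>
    rw [List.map_cons, List.prod_cons, List.map_cons (f := T), List.prod_cons]
    have e : ∀ x x' y y' : A[X], x' * y' - x * y = (x' - x) * y' + x * (y' - y) := by
      intros; noncomm_ring
    rw [e]
    refine dvd_add (X_pow_add_dvd_mul (h a) (X_pow_length_dvd hT' (b :: w))) ?_
    have := X_pow_add_dvd_mul (m := 1) (by simpa using hT a) (ih b)
    rwa [List.length_cons, ← add_assoc, add_comm (s + w.length)]

end XAdic

/-! ### Deforming commuting operators to satisfy the perturbed relations -/

section Deformation

open Polynomial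

variable {k : Type*} [CommRing k] {α : Type*} [Finite α] {Γ : SimpleGraph α}
  {A : Type*} [Ring A] [Algebra k A]

theorem X_pow_dvd_lift {T : α → A[X]} (hT : ∀ v, X ∣ T v) {n : ℕ} {q : FreeAlgebra k α}
    (hq : NCSeries.Agree n (NCSeries.ofPoly k α q) 0) : X ^ n ∣ FreeAlgebra.lift k T q := by
  have h := NCSeries.map_mem_of_agree hq (FreeAlgebra.lift k T).toLinearMap
    ((xPowIdeal A n).asIdeal.restrictScalars k) (fun w hw => by
      change FreeAlgebra.lift k T _ ∈ xPowIdeal A n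
      rw [mem_xPowIdeal, NCSeries.lift_word]
      exact (pow_dvd_pow X hw).trans (X_pow_length_dvd hT w))
  exact mem_xPowIdeal.mp h

/-- The gain of `n` comes from the factors that are not being replaced, at least `n` in each word of
`q`. For the error terms of order 3 the gain is 2, one more than the gain in the commutator, and
this is what lets the deformation proceed. -/
theorem X_pow_dvd_lift_sub {T T' : α → A[X]} {s n : ℕ} (hT : ∀ v, X ∣ T v)
    (hT' : ∀ v, X ∣ T' v) (h : ∀ v, X ^ s ∣ T' v - T v) {q : FreeAlgebra k α}
    (hq : NCSeries.Agree (n + 1) (NCSeries.ofPoly k α q) 0) :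
    X ^ (s + n) ∣ FreeAlgebra.lift k T' q - FreeAlgebra.lift k T q := by
  have h := NCSeries.map_mem_of_agree hq
    ((FreeAlgebra.lift k T').toLinearMap - (FreeAlgebra.lift k T).toLinearMap)
    ((xPowIdeal A (s + n)).asIdeal.restrictScalars k) (fun w hw => by
      change FreeAlgebra.lift k T' _ - FreeAlgebra.lift k T _ ∈ xPowIdeal A (s + n)
      rw [mem_xPowIdeal, NCSeries.lift_word, NCSeries.lift_word]
      cases w with
      | nil => simp at hw
      | cons a w =>
        refine (pow_dvd_pow X ?_).trans (X_pow_dvd_prod_sub hT hT' h a w)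
        simpa using hw)
  exact mem_xPowIdeal.mp h

theorem X_mul_C_mul_X_mul_C (a b : A) : X * C a * (X * C b) = X ^ 2 * C (a * b) := by
  rw [C_mul, mul_assoc, ← mul_assoc (C a), ← X_mul (p := C a)]
  simp only [mul_assoc, pow_two]

/-- Operators `L_v` that commute along the edges of `Γ` deform to operators which satisfy modulo
`X ^ (s + 3)` the perturbed relations `[X_i; X_j] = r_ij` for the edges `{i, j}` between `U`
and `W`. -/
theorem exists_deformation {L : α → A} (hL : ∀ i j, Γ.Adj i j → L i * L j = L j * L i)
    (hD : ∀ N : Finset α, (∀ i ∈ N, ∀ j ∈ N, ¬ Γ.Adj i j) → ∀ P : α → A,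
      ∃ D : A, ∀ j ∈ N, D * L j - L j * D = P j)
    {U W : Set α} (hUW : Disjoint U W)
    (hW : ∀ i ∈ W, ∀ j ∈ W, ¬ Γ.Adj i j) (r : α → α → FreeAlgebra k α)
    (hr : ∀ i j, NCSeries.Agree 3 (NCSeries.ofPoly k α (r i j)) 0) (s : ℕ) :
    ∃ T : α → A[X],
      (∀ v, X ^ 2 ∣ T v - X * C (L v)) ∧ (∀ v ∉ U, T v = X * C (L v)) ∧
      ∀ i ∈ U, ∀ j ∈ W, Γ.Adj i j →
        X ^ (s + 3) ∣ T i * T j - T j * T i - FreeAlgebra.lift k T (r i j) := by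
  classical
  have := Fintype.ofFinite α
  have hX : ∀ {T : α → A[X]}, (∀ v, X ^ 2 ∣ T v - X * C (L v)) → ∀ v, X ∣ T v := fun {T} hT v => by
    rw [← sub_add_cancel (T v) (X * C (L v))]
    exact dvd_add ((dvd_pow_self X two_ne_zero).trans (hT v)) (Dvd.intro _ rfl)
  induction s with
  | zero =>
    -- The undeformed operators satisfy the commutator relation exactly, so the error is only the
    -- value of `r i j`, of order 3.
    refine ⟨fun v => X * C (L v), fun v => by rw [sub_self]; exact dvd_zero _,
      fun v _ => rfl, fun i hi j hj hij => ?_⟩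
    rw [X_mul_C_mul_X_mul_C, X_mul_C_mul_X_mul_C, hL i j hij, sub_self, zero_sub, dvd_neg, zero_add]
    exact X_pow_dvd_lift (fun v => Dvd.intro _ rfl) (hr i j)
  | succ s ih =>
    obtain ⟨T, h2, hU, hT⟩ := ih
    set E : α → α → A[X] := fun i j => T i * T j - T j * T i - FreeAlgebra.lift k T (r i j)
    -- The commutators of `D i` with its neighbours in `W` are chosen to cancel the lowest error
    -- coefficients. Since operators outside `U` stay fixed, the equations for different `i` are
    -- independent of each other.
    choose D hD using fun i => hD {j | j ∈ W ∧ Γ.Adj i j}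
      (by simpa using fun a ha _ b hb _ => hW a ha b hb) fun j => -(E i j).coeff (s + 3)
    simp only [Finset.mem_filter, Finset.mem_univ, true_and, and_imp] at hD
    let T' : α → A[X] := fun v => if v ∈ U then T v + X ^ (s + 2) * C (D v) else T v
    have hd : ∀ v, X ^ (s + 2) ∣ T' v - T v := fun v => by
      by_cases hv : v ∈ U <;> simp [T', hv, -X_pow_mul_C]
    have h2' : ∀ v, X ^ 2 ∣ T' v - X * C (L v) := fun v => by
      rw [← sub_add_sub_cancel _ (T v)]
      exact dvd_add ((pow_dvd_pow X (Nat.le_add_left 2 s)).trans (hd v)) (h2 v)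
    refine ⟨T', h2', fun v hv => by simp only [T', if_neg hv, hU v hv], fun i hi j hj hij => ?_⟩
    have hj' : j ∉ U := Set.disjoint_right.mp hUW hj
    -- The perturbation changes by a multiple of `X ^ (s + 2 + 2)`, too high to disturb the
    -- coefficient being cancelled.
    have hr' := X_pow_dvd_lift_sub (n := 2) (hX h2) (hX h2') hd (hr i j)
    have e1 : T' i * T' j - T' j * T' i - FreeAlgebra.lift k T' (r i j) =
        (E i j + X ^ (s + 3) * C (D i * L j - L j * D i)) -
          (FreeAlgebra.lift k T' (r i j) - FreeAlgebra.lift k T (r i j)) := by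
      have e2 : X ^ (s + 2) * C (D i) * (X * C (L j)) = X ^ (s + 3) * C (D i * L j) := by
        rw [C_mul, mul_assoc, ← mul_assoc (C (D i)), ← X_mul (p := C (D i)), pow_succ X (s + 2)]
        simp only [mul_assoc]
      have e3 : X * C (L j) * (X ^ (s + 2) * C (D i)) = X ^ (s + 3) * C (L j * D i) := by
        rw [C_mul, mul_assoc, ← mul_assoc (C (L j)), ← X_pow_mul (p := C (L j)), pow_succ' X (s + 2)]
        simp only [mul_assoc]
      have e4 : T' i = T i + X ^ (s + 2) * C (D i) := if_pos hi
      have e5 : T' j = X * C (L j) := (if_neg hj').trans (hU j hj')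
      rw [C_sub, mul_sub, ← e2, ← e3, e4, e5]
      simp only [E, hU j hj']
      noncomm_ring
    rw [e1, show s + 1 + 3 = s + 2 + 2 from by ring]
    refine dvd_sub ?_ hr'
    rw [X_pow_dvd_iff]
    intro m hm
    rw [coeff_add]
    -- Below degree `s + 3` the old error already vanishes; in degree `s + 3` it is cancelled by `[D
    -- i, L j]`.
    rcases Nat.lt_succ_iff_lt_or_eq.mp hm with hm | rfl
    · rw [X_pow_dvd_iff.mp (hT i hi j hj hij) m hm, coeff_X_pow_mul', if_neg (by omega), add_zero]
    · rw [hD i j hj hij, coeff_X_pow_mul', if_pos le_rfl, Nat.sub_self, coeff_C_zero]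
      exact add_neg_cancel _

end Deformation

/-! ### Initial forms of a closed ideal: the upper bound -/

namespace NCSeries

section Closure

variable {k α : Type*} [CommRing k] [Finite α]

/-- There are finitely many words of each length, so coefficientwise convergence is the same as
convergence by degree. -/
theorem mem_closure_iff_agree {S : Set (NCSeries k α)} {f : NCSeries k α} :
    f ∈ closure S ↔ ∀ n, ∃ s ∈ S, Agree n s f := by
  let _ : TopologicalSpace k := ⊥
  have : DiscreteTopology k := ⟨rfl⟩
  constructor
  · intro hf n
    have ho : IsOpen {g : NCSeries k α | Agree n g f} := by
      have h := isOpen_set_pi (i := {w : List α | w.length < n}) (s := fun w => {f w})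
        (List.finite_length_lt α n) (fun w _ => isOpen_discrete _)
      refine (congrArg IsOpen (Set.ext fun g => ?_)).mpr h
      exact Iff.rfl
    obtain ⟨s, h1, h2⟩ := mem_closure_iff.mp hf _ ho (Agree.refl n f)
    exact ⟨s, h2, h1⟩
  · intro h
    rw [mem_closure_iff]
    intro O hO hfO
    obtain ⟨I, u, hu, hI⟩ := isOpen_pi_iff.mp hO f hfO
    obtain ⟨s, hs, hsf⟩ := h (I.sup List.length + 1)
    refine ⟨s, hI fun w hw => ?_, hs⟩
    rw [hsf w (Nat.lt_succ_of_le (Finset.le_sup (f := List.length) hw))]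
    exact (hu w hw).2

theorem ofPoly_injective : Function.Injective (ofPoly k α) := by
  intro q r h
  obtain ⟨m, hm⟩ := exists_trunc_ofPoly q
  obtain ⟨n, hn⟩ := exists_trunc_ofPoly r
  rw [← hm (max m n) (le_max_left _ _), ← hn (max m n) (le_max_right _ _), h]

/-- A polynomial lies in a submodule if all its homogeneous components do. -/
theorem mem_of_forall_homogeneous {S : Submodule k (FreeAlgebra k α)} {q : FreeAlgebra k α}
    (h : ∀ n, ∃ f, Agree n f 0 ∧ (∀ w : List α, w.length = n → f w = ofPoly k α q w) ∧
      trunc k α (n + 1) f ∈ S) : q ∈ S := by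
  obtain ⟨N, hN⟩ := exists_trunc_ofPoly q
  rw [← hN N le_rfl]
  clear hN
  induction N with
  | zero =>
    have : trunc k α 0 (ofPoly k α q) = 0 := by
      rw [← map_zero (trunc k α 0)]
      exact trunc_congr fun w hw => absurd hw (Nat.not_lt_zero _)
    rw [this]
    exact zero_mem _
  | succ n ih =>
    obtain ⟨f, h0, hf, hS⟩ := h n
    -- As `f` vanishes below degree `n`, its truncation to degrees at most `n` is exactly the degree
    -- `n` component of `q`.
    have : trunc k α (n + 1) (ofPoly k α q) =
        trunc k α n (ofPoly k α q) + trunc k α (n + 1) f := by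
      refine ofPoly_injective ?_
      funext w
      rw [map_add, add_apply, ofPoly_trunc, ofPoly_trunc, ofPoly_trunc]
      rcases lt_trichotomy w.length n with h | h | h
      · rw [if_pos (by omega), if_pos h, if_pos (by omega), h0 w h, zero_apply, add_zero]
      · rw [if_pos (by omega), if_neg (by omega), if_pos (by omega), hf w h, zero_add]
      · rw [if_neg (by omega), if_neg (by omega), if_neg (by omega), zero_add]
    rw [this]
    exact add_mem ih hS

end Closure

section Deformation

open Polynomial

variable {k : Type*} [CommRing k] {α : Type*} {Γ : SimpleGraph α}

/-- Each factor is `X` times a polynomial with constant term `L v`, so the lowest coefficient of the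
product is the product of the `L v`. -/
theorem coeff_prod_eq {A : Type*} [Ring A] {L : α → A} {T : α → A[X]}
    (hT : ∀ v, Polynomial.X ^ 2 ∣ T v - Polynomial.X * C (L v)) (w : List α) :
    (w.map T).prod.coeff w.length = (w.map L).prod := by
  have hT' : ∀ v, ∃ c, T v = Polynomial.X * c ∧ c.coeff 0 = L v := fun v => by
    obtain ⟨c, hc⟩ := hT v
    refine ⟨C (L v) + Polynomial.X * c, ?_, by simp⟩
    rw [mul_add, ← mul_assoc, ← pow_two, ← hc, add_sub_cancel]
  induction w with
  | nil => simp
  | cons a w ih =>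
    obtain ⟨c, hc, hc0⟩ := hT' a
    obtain ⟨e, he⟩ := X_pow_length_dvd (fun v => (hT' v).elim fun c hc => Dvd.intro _ hc.1.symm) w
    rw [List.map_cons, List.prod_cons, List.map_cons, List.prod_cons, List.length_cons, hc, mul_assoc,
      coeff_X_mul, ← ih, he, ← mul_assoc, ← X_pow_mul (p := c), mul_assoc]
    have h : ∀ p : A[X], (Polynomial.X ^ w.length * p).coeff w.length = p.coeff 0 := fun p => by
      rw [coeff_X_pow_mul', if_pos le_rfl, Nat.sub_self]
    rw [h, h, mul_coeff_zero, hc0]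

variable [Finite α]

/-- Only words of length exactly `n` occur in the truncation, so `coeff_prod_eq` applies to each
term. This reads the initial form off the deformed operators. -/
theorem coeff_lift_trunc {A : Type*} [Ring A] [Algebra k A] {L : α → A} {T : α → A[X]}
    (hT : ∀ v, Polynomial.X ^ 2 ∣ T v - Polynomial.X * C (L v)) {n : ℕ} {f : NCSeries k α}
    (hf : Agree n f 0) :
    (FreeAlgebra.lift k T (trunc k α (n + 1) f)).coeff n =
      FreeAlgebra.lift k L (trunc k α (n + 1) f) := by
  rw [trunc_apply, map_sum, map_sum, finsetSum_coeff]
  refine Finset.sum_congr rfl fun w hw => ?_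
  rw [map_smul, map_smul, coeff_smul, lift_word, lift_word]
  have hw' : w.length < n + 1 := by simpa using hw
  rcases Nat.lt_succ_iff_lt_or_eq.mp hw' with h | rfl
  · rw [hf w h, zero_apply, zero_smul, zero_smul]
  · rw [coeff_prod_eq hT]

/-- Initial forms of elements of the closed ideal generated by a set `S` of series, each of which is
either (up to a scalar) a perturbed commutator `[X_i; X_j] - ρ_ij` of an edge between `U` and `W`,
or a multiple of a commutator of an edge outside `U`. -/
theorem trunc_mem_raaIdeal {U W : Set α} (hUW : Disjoint U W)
    (hW : ∀ i ∈ W, ∀ j ∈ W, ¬ Γ.Adj i j) {ρ : α → α → NCSeries k α}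
    (hρ : ∀ i j, Agree 3 (ρ i j) 0) {S : Set (NCSeries k α)}
    (hS : ∀ f ∈ S,
      (∃ i ∈ U, ∃ j ∈ W, Γ.Adj i j ∧ ∃ c : k, f = c • (X i * X j - X j * X i - ρ i j)) ∨
      (∃ u ∉ U, ∃ v ∉ U, Γ.Adj u v ∧ ∃ a, f = a * (X u * X v - X v * X u)))
    {n : ℕ} {f : NCSeries k α} (hf : f ∈ closure (TwoSidedIdeal.span S : Set (NCSeries k α)))
    (h0 : Agree n f 0) : trunc k α (n + 1) f ∈ raaIdeal k Γ := by
  obtain ⟨T, h2, hU, hT⟩ := exists_deformation (L := raaMulX k Γ) (fun i j h => raaMulX_mul_comm h)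
    exists_commutator_eq hUW hW (fun i j => trunc k α (n + 3) (ρ i j))
    (fun i j => ((agree_ofPoly_trunc (n + 3) _).mono (Nat.le_add_left 3 n)).trans (hρ i j)) n
  have hX : ∀ v, Polynomial.X ∣ T v := fun v => by
    rw [← sub_add_cancel (T v) (Polynomial.X * C (raaMulX k Γ v))]
    exact dvd_add ((dvd_pow_self _ two_ne_zero).trans (h2 v)) (Dvd.intro _ rfl)
  set J := xPowIdeal (Module.End k (RAAAlgebra k Γ)) (n + 3) with hJ
  set m := J.ringCon.mkₐ k with hm
  have hmk : ∀ q, m q = 0 ↔ Polynomial.X ^ (n + 3) ∣ q := fun q => by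
    rw [← mem_xPowIdeal, ← map_zero m, hm, RingCon.mkₐ_apply, RingCon.mkₐ_apply, RingCon.eq,
      TwoSidedIdeal.rel_iff, sub_zero]
  have hnil : ∀ w : List α, n + 3 ≤ w.length → (w.map fun v => m (T v)).prod = 0 := fun w hw => by
    have : (w.map fun v => m (T v)).prod = m (w.map T).prod := by
      rw [map_list_prod, List.map_map]
      rfl
    rw [this, hmk]
    exact (pow_dvd_pow _ hw).trans (X_pow_length_dvd hX w)
  -- Since each `T v` is divisible by the polynomial variable, series can be evaluated at the `T v`
  -- modulo its power `n + 3`.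
  set ev := evalNil (k := k) (fun v => m (T v)) (n + 3) hnil with hev
  have hevm : ∀ g, ev g = m (FreeAlgebra.lift k T (trunc k α (n + 3) g)) := fun g => by
    rw [hev, evalNil_apply]
    have : FreeAlgebra.lift k (fun v => m (T v)) = m.comp (FreeAlgebra.lift k T) :=
      FreeAlgebra.hom_ext (funext fun v => by simp)
    rw [this]
    rfl
  have hevX : ∀ v, ev (X v) = m (T v) := fun v => evalNil_X _ _ _ v
  have hker : TwoSidedIdeal.span S ≤ TwoSidedIdeal.ker ev := by
    rw [TwoSidedIdeal.span_le]
    intro g hg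
    rw [SetLike.mem_coe, TwoSidedIdeal.mem_ker]
    rcases hS g hg with ⟨i, hi, j, hj, hij, c, rfl⟩ | ⟨u, hu, v, hv, huv, a, rfl⟩
    -- Edges between `U` and `W` vanish by the deformation. In the other case both operators are
    -- undeformed and commute exactly.
    · rw [map_smul, map_sub, map_sub, map_mul, map_mul, hevX, hevX, hevm, ← map_mul, ← map_mul,
        ← map_sub, ← map_sub, (hmk _).mpr (hT i hi j hj hij), smul_zero]
    · rw [map_mul, map_sub, map_mul, map_mul, hevX, hevX, ← map_mul, ← map_mul, hU u hu, hU v hv,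
        X_mul_C_mul_X_mul_C, X_mul_C_mul_X_mul_C, raaMulX_mul_comm huv, sub_self, mul_zero]
  obtain ⟨s, hs, hsf⟩ := mem_closure_iff_agree.mp hf (n + 3)
  have hevf : ev f = 0 := by
    rw [hev, ← evalNil_congr _ _ _ hsf]
    exact (TwoSidedIdeal.mem_ker _).mp (hker hs)
  rw [hevm, hmk] at hevf
  -- The terms of `f` of degree above `n` contribute nothing to the coefficient of index `n`, so
  -- they may be dropped.
  have hd := X_pow_dvd_lift (n := n + 1) hX
    (q := trunc k α (n + 3) f - trunc k α (n + 1) f) (by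
      rw [map_sub, agree_sub_zero]
      exact ((agree_ofPoly_trunc (n + 3) f).mono (by omega)).trans (agree_ofPoly_trunc _ f).symm)
  rw [map_sub, dvd_sub_right ((pow_dvd_pow _ (by omega)).trans hevf)] at hd
  rw [← mk_raaIdeal_eq_zero, ← lift_raaMulX_apply_one, ← coeff_lift_trunc h2 h0,
    Polynomial.X_pow_dvd_iff.mp hd n (Nat.lt_succ_self n)]
  rfl

end Deformation

end NCSeries

/-! ### The ideal of initial forms: the lower bound -/

namespace NCSeries

variable {k α : Type*} [CommRing k]

theorem X_apply_of_length_ne (i : α) {w : List α} (h : w.length ≠ 1) :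
    (X i : NCSeries k α) w = 0 := by
  classical
  rw [X, if_neg]
  rintro rfl
  exact h rfl

theorem X_mul_congr (i : α) {n : ℕ} {f g : NCSeries k α}
    (h : ∀ w : List α, w.length = n → f w = g w) (w : List α) (hw : w.length = n + 1) :
    (X i * f : NCSeries k α) w = (X i * g : NCSeries k α) w := by
  rw [mul_apply, mul_apply]
  refine Finset.sum_congr rfl fun a ha => ?_
  rw [Finset.mem_range] at ha
  by_cases h1 : a = 1
  · rw [h _ (by rw [List.length_drop]; omega)]
  · rw [X_apply_of_length_ne i (by rw [List.length_take]; omega), zero_mul, zero_mul]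

theorem mul_X_congr (i : α) {n : ℕ} {f g : NCSeries k α}
    (h : ∀ w : List α, w.length = n → f w = g w) (w : List α) (hw : w.length = n + 1) :
    (f * X i : NCSeries k α) w = (g * X i : NCSeries k α) w := by
  rw [mul_apply, mul_apply]
  refine Finset.sum_congr rfl fun a ha => ?_
  rw [Finset.mem_range] at ha
  by_cases h1 : a = n
  · rw [h _ (by rw [List.length_take]; omega)]
  · rw [X_apply_of_length_ne i (by rw [List.length_drop]; omega), mul_zero, mul_zero]

theorem X_mul_X_apply (i j : α) {w : List α} (hw : w.length ≠ 2) :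
    (X i * X j : NCSeries k α) w = 0 := by
  rw [mul_apply]
  refine Finset.sum_eq_zero fun a ha => ?_
  rw [Finset.mem_range] at ha
  by_cases h1 : a = 1
  · rw [X_apply_of_length_ne j (by rw [List.length_drop]; omega), mul_zero]
  · rw [X_apply_of_length_ne i (by rw [List.length_take]; omega), zero_mul]

theorem agree_X (i : α) : Agree 1 (X i : NCSeries k α) 0 := fun _ hw =>
  X_apply_of_length_ne i hw.ne

theorem agree_commutator (i j : α) : Agree 2 (X i * X j - X j * X i : NCSeries k α) 0 := by
  rw [agree_sub_zero]
  intro w hw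
  rw [X_mul_X_apply i j hw.ne, X_mul_X_apply j i hw.ne]

/-- The ideal of initial forms of an ideal of series, as an ideal of polynomials. -/
def initialForms (I : TwoSidedIdeal (NCSeries k α)) : TwoSidedIdeal (FreeAlgebra k α) :=
  TwoSidedIdeal.mk' {q | ∀ n : ℕ, ∃ f ∈ I, Agree n f 0 ∧
      ∀ w : List α, w.length = n → f w = ofPoly k α q w}
    (fun n => ⟨0, I.zero_mem, Agree.refl n 0, fun w _ => by simp⟩)
    (fun {x y} hx hy n => by
      obtain ⟨f, hf, hf0, hfx⟩ := hx n
      obtain ⟨g, hg, hg0, hgy⟩ := hy n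
      refine ⟨f + g, I.add_mem hf hg, by simpa using hf0.add hg0, fun w hw => ?_⟩
      rw [map_add, add_apply, add_apply, hfx w hw, hgy w hw])
    (fun {x} hx n => by
      obtain ⟨f, hf, hf0, hfx⟩ := hx n
      refine ⟨-f, I.neg_mem hf, fun w hw => ?_, fun w hw => ?_⟩
      · rw [neg_apply, hf0 w hw, zero_apply, neg_zero]
      · rw [map_neg, neg_apply, neg_apply, hfx w hw])
    (fun {x y} hy => by
      induction x using FreeAlgebra.induction generalizing y with
      | grade0 r =>
        intro n
        obtain ⟨f, hf, hf0, hfx⟩ := hy n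
        refine ⟨algebraMap k _ r * f, I.mul_mem_left _ _ hf, ?_, fun w hw => ?_⟩
        · simpa using (Agree.refl n (algebraMap k _ r)).mul hf0
        · rw [map_mul, AlgHom.commutes, ← Algebra.smul_def, ← Algebra.smul_def, smul_apply,
            smul_apply, hfx w hw]
      | grade1 i =>
        intro n
        cases n with
        | zero =>
          -- A left multiple of a variable has no constant term. In positive degree, multiplication
          -- by `X i` shifts a witness for degree `n` to one for `n + 1`.
          refine ⟨0, I.zero_mem, Agree.refl 0 0, fun w hw => ?_⟩
          rw [List.length_eq_zero_iff.mp hw, map_mul, ofPoly_ι, X_mul_nil, zero_apply]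
        | succ n =>
          obtain ⟨f, hf, hf0, hfx⟩ := hy n
          refine ⟨X i * f, I.mul_mem_left _ _ hf, ?_, fun w hw => ?_⟩
          · rw [add_comm]
            exact (agree_X i).mul_of_zero hf0
          · rw [map_mul, ofPoly_ι]
            exact X_mul_congr i hfx w hw
      | add a b ha hb =>
        intro n
        obtain ⟨f, hf, hf0, hfx⟩ := ha hy n
        obtain ⟨g, hg, hg0, hgy⟩ := hb hy n
        refine ⟨f + g, I.add_mem hf hg, by simpa using hf0.add hg0, fun w hw => ?_⟩
        rw [add_mul, map_add, add_apply, add_apply, hfx w hw, hgy w hw]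
      | mul a b ha hb =>
        rw [mul_assoc]
        exact ha (hb hy))
    (fun {y x} hy => by
      induction x using FreeAlgebra.induction generalizing y with
      | grade0 r =>
        intro n
        obtain ⟨f, hf, hf0, hfx⟩ := hy n
        refine ⟨f * algebraMap k _ r, I.mul_mem_right _ _ hf, ?_, fun w hw => ?_⟩
        · simpa using hf0.mul (Agree.refl n (algebraMap k _ r))
        · rw [map_mul, AlgHom.commutes, ← Algebra.commutes, ← Algebra.commutes,
            ← Algebra.smul_def, ← Algebra.smul_def, smul_apply, smul_apply, hfx w hw]
      | grade1 i =>
        intro n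
        cases n with
        | zero =>
          refine ⟨0, I.zero_mem, Agree.refl 0 0, fun w hw => ?_⟩
          rw [List.length_eq_zero_iff.mp hw, map_mul, ofPoly_ι, mul_nil, X_nil, mul_zero, zero_apply]
        | succ n =>
          obtain ⟨f, hf, hf0, hfx⟩ := hy n
          refine ⟨f * X i, I.mul_mem_right _ _ hf, ?_, fun w hw => ?_⟩
          · exact hf0.mul_of_zero (agree_X i)
          · rw [map_mul, ofPoly_ι]
            exact mul_X_congr i hfx w hw
      | add a b ha hb =>
        intro n
        obtain ⟨f, hf, hf0, hfx⟩ := ha hy n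
        obtain ⟨g, hg, hg0, hgy⟩ := hb hy n
        refine ⟨f + g, I.add_mem hf hg, by simpa using hf0.add hg0, fun w hw => ?_⟩
        rw [mul_add, map_add, add_apply, add_apply, hfx w hw, hgy w hw]
      | mul a b ha hb =>
        rw [← mul_assoc]
        exact hb (ha hy))

theorem mem_initialForms {I : TwoSidedIdeal (NCSeries k α)} {q : FreeAlgebra k α} :
    q ∈ initialForms I ↔ ∀ n : ℕ, ∃ f ∈ I, Agree n f 0 ∧
      ∀ w : List α, w.length = n → f w = ofPoly k α q w :=
  TwoSidedIdeal.mem_mk' _ _ _ _ _ _ _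

/-- A commutator is homogeneous of degree 2, so a series of `I` starting with it is the witness in
degree 2, and `0` is the witness in all other degrees. -/
theorem raaIdeal_le_initialForms {Γ : SimpleGraph α} {I : TwoSidedIdeal (NCSeries k α)}
    (h : ∀ i j, Γ.Adj i j → ∃ f ∈ I, Agree 3 f (X i * X j - X j * X i)) :
    raaIdeal k Γ ≤ initialForms I := by
  rw [raaIdeal, TwoSidedIdeal.span_le]
  rintro _ ⟨i, j, hij, rfl⟩
  rw [SetLike.mem_coe, mem_initialForms]
  intro n
  rw [map_sub, map_mul, map_mul, ofPoly_ι, ofPoly_ι]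
  by_cases hn : n = 2
  · subst hn
    obtain ⟨f, hf, hf3⟩ := h i j hij
    exact ⟨f, hf, (hf3.mono (by norm_num)).trans (agree_commutator i j),
      fun w hw => hf3 w (by omega)⟩
  · refine ⟨0, I.zero_mem, Agree.refl n 0, fun w hw => ?_⟩
    rw [sub_apply, X_mul_X_apply i j (hw ▸ hn), X_mul_X_apply j i (hw ▸ hn), sub_zero, zero_apply]

end NCSeries

/-! ### The relators, and the equality of `Grad(I)` with `𝓘(Γ)` -/

section GradCondition

open NCSeries

variable {p d : ℕ} [Fact p.Prime]

/-- In any group ring `[x, y] - 1 = (y x)⁻¹ (x y - y x)`, and the constants cancel when `x = 1 +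
X_u`, `y = 1 + X_v`. Such a relator is thus an exact multiple of the commutator, with no higher
terms to correct. -/
theorem relSeries_commutator (u v : Fin d) :
    relSeries (p := p) ((FreeProP.x u)⁻¹ * (FreeProP.x v)⁻¹ * FreeProP.x u * FreeProP.x v) =
      FreeProP.magnus p d ((FreeProP.x u)⁻¹ * (FreeProP.x v)⁻¹) * (X u * X v - X v * X u) := by
  have h1 : FreeProP.magnus p d ((FreeProP.x u)⁻¹ * (FreeProP.x v)⁻¹) *
      ((1 + X v) * (1 + X u)) = 1 := by
    rw [← FreeProP.magnus_x, ← FreeProP.magnus_x, ← map_mul, ← map_mul, ← map_one (FreeProP.magnus p d)]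
    congr 1
    group
  have h2 : (X u * X v - X v * X u : NCSeries (ZMod p) (Fin d)) =
      (1 + X u) * (1 + X v) - (1 + X v) * (1 + X u) := by noncomm_ring
  rw [h2, mul_sub, h1, relSeries, mul_assoc _ (FreeProP.x u), map_mul, map_mul _ (FreeProP.x u),
    FreeProP.magnus_x, FreeProP.magnus_x]

theorem commutator_eq_mul_relSeries (u v : Fin d) :
    (X u * X v - X v * X u : NCSeries (ZMod p) (Fin d)) = FreeProP.magnus p d (FreeProP.x v *
      FreeProP.x u) * relSeries (p := p)
        ((FreeProP.x u)⁻¹ * (FreeProP.x v)⁻¹ * FreeProP.x u * FreeProP.x v) := by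
  rw [relSeries_commutator, ← mul_assoc, ← map_mul]
  have h : (FreeProP.x v * FreeProP.x u * ((FreeProP.x u)⁻¹ * (FreeProP.x v)⁻¹) : FreeProP p d) = 1 := by
    group
  rw [h, map_one, one_mul]

variable {Γ : SimpleGraph (Fin d)} {l : Γ.edgeSet → FreeProP p d}

theorem mk_edge_comm {i j : Fin d} (h : Γ.Adj i j) :
    (⟨s(i, j), h⟩ : Γ.edgeSet) = ⟨s(j, i), h.symm⟩ :=
  Subtype.ext Sym2.eq_swap

/-- The sign `c` absorbs the orientation: the relator may start with `[X_i; X_j]` or its negative,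
while the deformation wants the edge directed from one colour class to the other. -/
theorem exists_relSeries_eq {S : Set (Fin d)} (hS : ∀ i j, Γ.Adj i j → (i ∈ S ↔ j ∈ S))
    (hA : ∀ e : Γ.edgeSet, (∀ v ∈ e.1, v ∈ S) → ∃ i j, e.1 = s(i, j) ∧
      relSeries (l e) - (NCSeries.X i * NCSeries.X j - NCSeries.X j * NCSeries.X i) ∈
        augPow (NCSeries.aug (ZMod p) (Fin d)) 3) (i j : Fin d) :
    ∃ r : NCSeries (ZMod p) (Fin d), Agree 3 r 0 ∧ ∀ h : Γ.Adj i j, i ∈ S →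
      ∃ c : ZMod p, c * c = 1 ∧ relSeries (l ⟨s(i, j), h⟩) = c • (X i * X j - X j * X i - r) := by
  by_cases h : Γ.Adj i j ∧ i ∈ S
  · obtain ⟨h, hi⟩ := h
    obtain ⟨a, b, hab, hr⟩ := hA ⟨s(i, j), h⟩ (by simp [hi, (hS i j h).mp hi])
    have hr' := agree_of_mem_augPow hr
    rcases Sym2.eq_iff.mp hab with ⟨rfl, rfl⟩ | ⟨rfl, rfl⟩
    · refine ⟨X i * X j - X j * X i - relSeries (l ⟨s(i, j), h⟩), ?_, fun _ _ => ⟨1, by simp, ?_⟩⟩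
      · rw [agree_sub_zero] at hr' ⊢
        exact hr'.symm
      · rw [one_smul]
        abel
    · refine ⟨X i * X j - X j * X i + relSeries (l ⟨s(i, j), h⟩), ?_, fun _ _ => ⟨-1, by simp, ?_⟩⟩
      · have e : (X i * X j - X j * X i + relSeries (l ⟨s(i, j), h⟩) : NCSeries (ZMod p) (Fin d)) =
          relSeries (l ⟨s(i, j), h⟩) - (X j * X i - X i * X j) := by abel
        rw [e]
        exact hr'
      · rw [neg_smul, one_smul]
        abel
  · exact ⟨0, Agree.refl 3 0, fun h1 h2 => absurd ⟨h1, h2⟩ h⟩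

theorem gradIdeal_eq (hl : GradCondition Γ l) :
    gradIdeal (relIdeal l) = (raaIdeal (ZMod p) Γ : Set (FreeAlgebra (ZMod p) (Fin d))) := by
  obtain ⟨S, hS, ⟨c⟩, hA, hB⟩ := hl
  choose ρ hρ hρc using exists_relSeries_eq hS hA
  have hB' : ∀ i j (h : Γ.Adj i j), i ∉ S → ∃ u v, s(i, j) = s(u, v) ∧
      l ⟨s(i, j), h⟩ = (FreeProP.x u)⁻¹ * (FreeProP.x v)⁻¹ * FreeProP.x u * FreeProP.x v :=
    fun i j h hi => hB ⟨s(i, j), h⟩ (by simp [hi, mt (hS i j h).mpr hi])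
  refine Set.Subset.antisymm (fun q hq => ?_) (fun q hq => ?_)
  -- The two colour classes of `Γ_A`; vertices of `Γ_B` lie in neither.
  · let U : Set (Fin d) := {v | ∃ h : v ∈ S, c ⟨v, h⟩ = 0}
    let W : Set (Fin d) := {v | ∃ h : v ∈ S, c ⟨v, h⟩ = 1}
    have hUW : Disjoint U W := by
      rw [Set.disjoint_left]
      rintro v ⟨h, h0⟩ ⟨_, h1⟩
      simp [h0] at h1
    have hW : ∀ i ∈ W, ∀ j ∈ W, ¬ Γ.Adj i j := by
      rintro i ⟨hi, hi1⟩ j ⟨hj, hj1⟩ hij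
      exact c.valid (v := ⟨i, hi⟩) (w := ⟨j, hj⟩) hij (hi1.trans hj1.symm)
    have hrel : ∀ f ∈ Set.range fun e => relSeries (l e),
        (∃ i ∈ U, ∃ j ∈ W, Γ.Adj i j ∧ ∃ c : ZMod p, f = c • (X i * X j - X j * X i - ρ i j)) ∨
        (∃ u ∉ U, ∃ v ∉ U, Γ.Adj u v ∧ ∃ a, f = a * (X u * X v - X v * X u)) := by
      rintro _ ⟨⟨e, he⟩, rfl⟩
      induction e with
      | h i j =>
      have hij : Γ.Adj i j := he
      by_cases hi : i ∈ S
      · left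
        have hj := (hS i j hij).mp hi
        have hne : c ⟨i, hi⟩ ≠ c ⟨j, hj⟩ := c.valid hij
        have h01 : ∀ a b : Fin 2, a ≠ b → (a = 0 ∧ b = 1) ∨ (b = 0 ∧ a = 1) := by decide
        rcases h01 _ _ hne with ⟨h0, h1⟩ | ⟨h0, h1⟩
        · obtain ⟨a, -, ha⟩ := hρc i j hij hi
          exact ⟨i, ⟨hi, h0⟩, j, ⟨hj, h1⟩, hij, a, ha⟩
        · obtain ⟨a, -, ha⟩ := hρc j i hij.symm hj
          refine ⟨j, ⟨hj, h0⟩, i, ⟨hi, h1⟩, hij.symm, a, ?_⟩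
          rw [← ha]
          exact congrArg (fun e => relSeries (l e)) (mk_edge_comm hij)
      · right
        obtain ⟨u, v, huv, hl⟩ := hB' i j hij hi
        have hadj : Γ.Adj u v := by
          rw [← SimpleGraph.mem_edgeSet, ← huv]
          exact hij
        have hu : u ∉ S ∧ v ∉ S := by
          have hj := mt (hS i j hij).mpr hi
          rcases Sym2.eq_iff.mp huv with ⟨rfl, rfl⟩ | ⟨rfl, rfl⟩
          exacts [⟨hi, hj⟩, ⟨hj, hi⟩]
        refine ⟨u, fun h => hu.1 h.1, v, fun h => hu.2 h.1, hadj,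
          FreeProP.magnus p d ((FreeProP.x u)⁻¹ * (FreeProP.x v)⁻¹), ?_⟩
        exact (congrArg relSeries hl).trans (relSeries_commutator u v)
    rw [SetLike.mem_coe, ← mk_raaIdeal_eq_zero]
    refine mem_of_forall_homogeneous (S := LinearMap.ker
      ((raaIdeal (ZMod p) Γ).ringCon.mkₐ (ZMod p)).toLinearMap) fun n => ?_
    obtain ⟨f, hf, hf0, hfq⟩ := hq n
    have hf0 := agree_of_mem_augPow hf0
    refine ⟨f, hf0, hfq, ?_⟩
    exact mk_raaIdeal_eq_zero.mpr (trunc_mem_raaIdeal hUW hW hρ hrel hf hf0)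
  · have h := raaIdeal_le_initialForms (Γ := Γ)
      (I := TwoSidedIdeal.span (Set.range fun e => relSeries (l e))) (fun i j hij => by
        have hmem : relSeries (l ⟨s(i, j), hij⟩) ∈
            TwoSidedIdeal.span (Set.range fun e => relSeries (l e)) :=
          TwoSidedIdeal.subset_span ⟨_, rfl⟩
        by_cases hi : i ∈ S
        · obtain ⟨a, ha, hr⟩ := hρc i j hij hi
          -- As `a * a = 1`, multiplying by the sign again gives the commutator with the orientation
          -- `(i, j)`, up to order 3.
          refine ⟨a • relSeries (l ⟨s(i, j), hij⟩), ?_, ?_⟩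
          · rw [Algebra.smul_def]
            exact TwoSidedIdeal.mul_mem_left _ _ _ hmem
          · rw [hr, smul_smul, ha, one_smul]
            intro w hw
            rw [NCSeries.sub_apply, hρ i j w hw, NCSeries.zero_apply, sub_zero]
        · obtain ⟨u, v, huv, hl⟩ := hB' i j hij hi
          have hc : ∃ f ∈ TwoSidedIdeal.span (Set.range fun e => relSeries (l e)),
              f = X u * X v - X v * X u := by
            refine ⟨_, ?_, (commutator_eq_mul_relSeries u v).symm⟩
            rw [← hl]
            exact TwoSidedIdeal.mul_mem_left _ _ _ hmem
          obtain ⟨f, hf, rfl⟩ := hc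
          rcases Sym2.eq_iff.mp huv with ⟨rfl, rfl⟩ | ⟨rfl, rfl⟩
          · exact ⟨_, hf, Agree.refl _ _⟩
          · refine ⟨_, TwoSidedIdeal.neg_mem _ hf, ?_⟩
            rw [neg_sub]
            exact Agree.refl _ _) hq
    rw [mem_initialForms] at h
    intro n
    obtain ⟨f, hf, hf0, hfq⟩ := h n
    exact ⟨f, subset_closure hf, mem_augPow_iff.mpr hf0, hfq⟩

end GradCondition

/-! ### Nilpotence of the augmentation ideal of a finite `p`-group -/

section Nilpotent

variable {p : ℕ} [Fact p.Prime] {P : Type*} [Group P]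

/-- The elements of the group algebra that are killed by long products of elements `g - 1`. -/
def unipotentPart (k P : Type*) [CommRing k] [Group P] : Ideal (MonoidAlgebra k P) where
  carrier := {a | ∃ n, ∀ w : List P, n ≤ w.length →
    (w.map fun g => MonoidAlgebra.of k P g - 1).prod * a = 0}
  zero_mem' := ⟨0, fun _ _ => mul_zero _⟩
  add_mem' := by
    rintro a b ⟨m, hm⟩ ⟨n, hn⟩
    refine ⟨max m n, fun w hw => ?_⟩
    rw [mul_add, hm w (le_of_max_le_left hw), hn w (le_of_max_le_right hw), add_zero]
  smul_mem' := by
    rintro c a ⟨n, hn⟩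
    refine ⟨n, fun w hw => ?_⟩
    induction c using MonoidAlgebra.induction_on with
    | of g =>
      -- Appending `g` gives `Q (g - 1) a = 0` for the product `Q` attached to `w`, hence `Q g a = Q
      -- a = 0`.
      have h1 := hn (w ++ [g]) (hw.trans (by simp))
      rw [List.map_append, List.prod_append, List.map_singleton, List.prod_singleton, mul_assoc,
        sub_mul, one_mul, mul_sub, hn w hw, sub_zero] at h1
      exact h1
    | add c e hc he => rw [add_smul, mul_add, hc, he, add_zero]
    | smul r c hc => rw [smul_assoc, mul_smul_comm, hc, smul_zero]

/-- A `p`-group acting on a nonzero finite `𝔽_p`-space fixes a nonzero vector. Applied to the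
quotient by `unipotentPart`, this gives an `a` outside it with every `(g - 1) a` inside it; as `P`
is finite the bounds are uniform, so `a` lies inside after all. -/
theorem unipotentPart_eq_top [Finite P] (hP : IsPGroup p P) : unipotentPart (ZMod p) P = ⊤ := by
  by_contra hne
  set A := MonoidAlgebra (ZMod p) P
  set Z : Ideal A := unipotentPart (ZMod p) P with hZ
  have hfin : Finite A := Module.finite_of_finite (ZMod p)
  have : Finite (A ⧸ Z) := Finite.of_surjective _ (Submodule.mkQ_surjective Z)
  have : Nontrivial (A ⧸ Z) := Submodule.Quotient.nontrivial_iff.mpr hne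
  let _ : MulAction P (A ⧸ Z) := MulAction.compHom _ (MonoidAlgebra.of (ZMod p) P)
  have hsmul : ∀ (g : P) (a : A ⧸ Z), g • a = MonoidAlgebra.of (ZMod p) P g • a := fun _ _ => rfl
  have hcard : p ∣ Nat.card (A ⧸ Z) := by
    obtain ⟨x, hx⟩ := exists_ne (0 : A ⧸ Z)
    have hpx : p • x = 0 := by
      have h0 : ((p : ZMod p) • (1 : A)) • x = 0 := by simp
      rwa [Nat.cast_smul_eq_nsmul, smul_assoc, one_smul] at h0
    exact (addOrderOf_eq_prime hpx hx).symm.dvd.trans (addOrderOf_dvd_natCard x)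
  obtain ⟨b, hb, hb0⟩ := hP.exists_fixed_point_of_prime_dvd_card_of_fixed_point (A ⧸ Z) hcard
    (a := 0) (fun g => by rw [hsmul, smul_zero])
  obtain ⟨a, rfl⟩ := Submodule.mkQ_surjective Z b
  have hg : ∀ g : P, (MonoidAlgebra.of (ZMod p) P g - 1) * a ∈ Z := fun g => by
    have h1 := hb g
    rw [hsmul, ← map_smul, ← sub_eq_zero, ← map_sub] at h1
    have h2 := (Submodule.Quotient.mk_eq_zero Z).mp h1
    rwa [sub_mul, one_mul]
  choose n hn using hg
  have := Fintype.ofFinite P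
  -- The extra `1` pays for the last factor of the word, which is the one that moves `a` into `Z`.
  refine hb0.symm ((Submodule.Quotient.mk_eq_zero Z).mpr ⟨Finset.univ.sup n + 1, fun w hw => ?_⟩)
  rcases List.eq_nil_or_concat w with rfl | ⟨v, g, rfl⟩
  · simp at hw
  · rw [List.concat_eq_append, List.map_append, List.prod_append, List.map_singleton,
      List.prod_singleton, mul_assoc]
    refine hn g v ((Finset.le_sup (Finset.mem_univ g)).trans ?_)
    simpa using hw

/-- The augmentation ideal of the group algebra of a finite `p`-group over `𝔽_p` is nilpotent. -/
theorem exists_prod_of_sub_one_eq_zero [Finite P] (hP : IsPGroup p P) :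
    ∃ n, ∀ w : List P, n ≤ w.length →
      (w.map fun g => MonoidAlgebra.of (ZMod p) P g - 1).prod = 0 := by
  have h : (1 : MonoidAlgebra (ZMod p) P) ∈ unipotentPart (ZMod p) P := by
    rw [unipotentPart_eq_top hP]
    trivial
  obtain ⟨n, hn⟩ := h
  exact ⟨n, fun w hw => by simpa using hn w hw⟩

end Nilpotent

/-! ### Topology of the free pro-`p` group and its continuous quotients -/

section ProP

variable {p : ℕ} {H : Type*} [Group H]

namespace PKernel

instance (N : PKernel p H) : Finite N.Quot := N.finite

theorem proj_surjective (N : PKernel p H) : Function.Surjective N.proj :=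
  QuotientGroup.mk'_surjective N.sub

theorem proj_eq_one {N : PKernel p H} {h : H} : N.proj h = 1 ↔ h ∈ N.sub :=
  QuotientGroup.eq_one_iff h

theorem exists_pow_mem (N : PKernel p H) (h : H) : ∃ n, h ^ p ^ n ∈ N.sub := by
  obtain ⟨n, hn⟩ := N.isPGroup (h : H ⧸ N.sub)
  exact ⟨n, (QuotientGroup.eq_one_iff _).mp hn⟩

/-- The intersection of two normal subgroups with finite `p`-group quotients. -/
def inf (N M : PKernel p H) : PKernel p H where
  sub := N.sub ⊓ M.sub
  normal := inferInstance
  finite := by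
    have := N.finite
    have := M.finite
    have := Subgroup.finiteIndex_of_finite_quotient (H := N.sub)
    have := Subgroup.finiteIndex_of_finite_quotient (H := M.sub)
    exact Subgroup.finite_quotient_of_finiteIndex
  isPGroup := by
    intro q
    obtain ⟨h, rfl⟩ := QuotientGroup.mk_surjective q
    obtain ⟨m, hm⟩ := N.exists_pow_mem h
    obtain ⟨n, hn⟩ := M.exists_pow_mem h
    refine ⟨m + n, (QuotientGroup.eq_one_iff _).mpr ⟨?_, ?_⟩⟩
    · change h ^ p ^ (m + n) ∈ N.sub
      rw [pow_add, pow_mul]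
      exact pow_mem hm _
    · change h ^ p ^ (m + n) ∈ M.sub
      rw [add_comm, pow_add, pow_mul]
      exact pow_mem hn _

/-- The whole group. -/
def top : PKernel p H where
  sub := ⊤
  normal := inferInstance
  finite := inferInstance
  isPGroup :=
    have : Subsingleton (H ⧸ (⊤ : Subgroup H)) := QuotientGroup.subsingleton_quotient_top
    IsPGroup.of_subsingleton p (H ⧸ (⊤ : Subgroup H))

theorem exists_le (s : Finset (PKernel p H)) : ∃ N : PKernel p H, ∀ M ∈ s, N.sub ≤ M.sub := by
  classical
  induction s using Finset.induction_on with
  | empty => exact ⟨top, by simp⟩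
  | insert M s _ ih =>
    obtain ⟨N, hN⟩ := ih
    refine ⟨inf M N, fun K hK => ?_⟩
    rcases Finset.mem_insert.mp hK with rfl | hK
    · exact inf_le_left
    · exact inf_le_right.trans (hN K hK)

end PKernel

namespace proPCompletion

theorem continuous_eval (N : PKernel p H) :
    Continuous fun f : proPCompletion p H => f.1 N :=
  (continuous_apply N).comp continuous_subtype_val

instance : CompactSpace (proPCompletion p H) := by
  refine isCompact_iff_compactSpace.mp (IsClosed.isCompact ?_)
  have : (proPCompletion p H : Set (∀ N : PKernel p H, N.Quot)) =
      ⋂ (N : PKernel p H) (M : PKernel p H) (h : N.sub ≤ M.sub),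
        {f | PKernel.trans h (f N) = f M} := by
    ext f
    simp only [Set.mem_iInter]
    rfl
  rw [this]
  refine isClosed_iInter fun N => isClosed_iInter fun M => isClosed_iInter fun h => ?_
  exact isClosed_eq ((continuous_of_discreteTopology (f := PKernel.trans h)).comp
    (continuous_apply N)) (continuous_apply M)

/-- A basic open set constrains finitely many coordinates, and these all factor through the quotient
by the intersection of the corresponding kernels. -/
theorem exists_forall_mem_of_isOpen {V : Set (proPCompletion p H)} (hV : IsOpen V)
    {f : proPCompletion p H} (hf : f ∈ V) :
    ∃ N : PKernel p H, ∀ g : proPCompletion p H, g.1 N = f.1 N → g ∈ V := by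
  obtain ⟨O, hO, rfl⟩ := isOpen_induced_iff.mp hV
  obtain ⟨s, u, hu, hs⟩ := isOpen_pi_iff.mp hO f.1 hf
  obtain ⟨N, hN⟩ := PKernel.exists_le s
  refine ⟨N, fun g hg => hs fun M hM => ?_⟩
  rw [← g.2 N M (hN M hM), hg, f.2 N M (hN M hM)]
  exact (hu M hM).2

end proPCompletion

end ProP

namespace FreeProP

variable {p d : ℕ}

theorem exists_ofFree_mem {V : Set (FreeProP p d)} (hV : IsOpen V) {f : FreeProP p d}
    (hf : f ∈ V) : ∃ h, ofFree p d h ∈ V := by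
  obtain ⟨N, hN⟩ := proPCompletion.exists_forall_mem_of_isOpen hV hf
  obtain ⟨h, hh⟩ := N.proj_surjective (f.1 N)
  exact ⟨h, hN _ hh⟩

variable [Fact p.Prime]

theorem agree_magnus {f g : FreeProP p d} {n : ℕ} (h : f.1 (level p d n) = g.1 (level p d n)) :
    NCSeries.Agree n (magnus p d f) (magnus p d g) :=
  (agree_magnusFun (mk_approx f n)).trans
    (agree_magnusFun ((mk_approx f n).trans h)).symm

variable {G : Type*} [Group G] [TopologicalSpace G] {π : FreeProP p d →* G}

omit [Fact p.Prime] in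
theorem exists_PKernel_le (hc : Continuous π) (U : OpenNormalSubgroup G) :
    ∃ N : PKernel p (FreeGroup (Fin d)), ∀ f : FreeProP p d, f.1 N = 1 → π f ∈ U.toSubgroup := by
  obtain ⟨N, hN⟩ := proPCompletion.exists_forall_mem_of_isOpen
    (U.toOpenSubgroup.isOpen.preimage hc) (f := 1)
    (by change π 1 ∈ U.toSubgroup; rw [map_one]; exact one_mem _)
  exact ⟨N, fun f hf => hN f hf⟩

-- By continuity `G / U` receives a map from a finite `p`-quotient of the abstract free group, and
-- density of that group makes the map onto.
omit [Fact p.Prime] in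
theorem finite_and_isPGroup_quotient (hc : Continuous π) (hs : Function.Surjective π)
    (U : OpenNormalSubgroup G) : Finite (G ⧸ U.toSubgroup) ∧ IsPGroup p (G ⧸ U.toSubgroup) := by
  obtain ⟨N, hN⟩ := exists_PKernel_le hc U
  let φ : N.Quot →* G ⧸ U.toSubgroup :=
    QuotientGroup.lift N.sub ((QuotientGroup.mk' U.toSubgroup).comp (π.comp (ofFree p d)))
      (fun h hh => (QuotientGroup.eq_one_iff _).mpr (hN _ (PKernel.proj_eq_one.mpr hh)))
  have hφ : Function.Surjective φ := by
    intro q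
    obtain ⟨g, rfl⟩ := QuotientGroup.mk_surjective q
    obtain ⟨f, rfl⟩ := hs g
    obtain ⟨h, hh⟩ := N.proj_surjective (f.1 N)
    refine ⟨N.proj h, QuotientGroup.eq.mpr ?_⟩
    rw [← map_inv]
    change π _ * π f ∈ _
    rw [← map_mul]
    refine hN _ ?_
    change (N.proj h)⁻¹ * f.1 N = 1
    rw [hh, inv_mul_cancel]
  exact ⟨Finite.of_surjective φ hφ, N.isPGroup.of_surjective φ hφ⟩

end FreeProP

/-! ### The map from series to the completed group algebra -/

section MagnusGroupAlgebra

open NCSeries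

variable {p d : ℕ} [Fact p.Prime] {G : Type*} [Group G] [TopologicalSpace G]
  {π : FreeProP p d →* G}

theorem exists_level_prod_eq_zero (hc : Continuous π) (hs : Function.Surjective π)
    (U : OpenNormalSubgroup G) : ∃ n, ∀ w : List (Fin d), n ≤ w.length →
      (w.map fun i => MonoidAlgebra.of (ZMod p) (G ⧸ U.toSubgroup) (π (FreeProP.x i)) - 1).prod
        = 0 := by
  obtain ⟨hf, hp⟩ := FreeProP.finite_and_isPGroup_quotient hc hs U
  obtain ⟨n, hn⟩ := exists_prod_of_sub_one_eq_zero hp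
  refine ⟨n, fun w hw => ?_⟩
  have h := hn (w.map fun i => (π (FreeProP.x i) : G ⧸ U.toSubgroup)) (by simpa using hw)
  rwa [List.map_map] at h

/-- The level of truncation at which series are evaluated in the group algebra of `G / U`. -/
noncomputable def evalLevel (hc : Continuous π) (hs : Function.Surjective π)
    (U : OpenNormalSubgroup G) : ℕ := (exists_level_prod_eq_zero hc hs U).choose

/-- The evaluation `X_i ↦ x_i - 1` of series in the group algebra of `G / U`. -/
noncomputable def evalQuot (hc : Continuous π) (hs : Function.Surjective π)
    (U : OpenNormalSubgroup G) :
    NCSeries (ZMod p) (Fin d) →ₐ[ZMod p] MonoidAlgebra (ZMod p) (G ⧸ U.toSubgroup) :=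
  evalNil (fun i => MonoidAlgebra.of (ZMod p) (G ⧸ U.toSubgroup) (π (FreeProP.x i)) - 1)
    (evalLevel hc hs U) (exists_level_prod_eq_zero hc hs U).choose_spec

variable (hc : Continuous π) (hs : Function.Surjective π)

theorem evalQuot_congr (U : OpenNormalSubgroup G) {f g : NCSeries (ZMod p) (Fin d)}
    (h : Agree (evalLevel hc hs U) f g) : evalQuot hc hs U f = evalQuot hc hs U g :=
  evalNil_congr _ _ _ h

theorem evalQuot_X (U : OpenNormalSubgroup G) (i : Fin d) :
    evalQuot hc hs U (X i) =
      MonoidAlgebra.of (ZMod p) (G ⧸ U.toSubgroup) (π (FreeProP.x i)) - 1 :=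
  evalNil_X _ _ _ i

/-- Two algebra homomorphisms that depend only on truncations agree if they agree on the
variables. -/
theorem NCSeries.hom_ext_of_agree {k α A : Type*} [CommRing k] [Finite α] [Ring A] [Algebra k A]
    {φ ψ : NCSeries k α →ₐ[k] A} {m n : ℕ} (hφ : ∀ f g, Agree m f g → φ f = φ g)
    (hψ : ∀ f g, Agree n f g → ψ f = ψ g) (h : ∀ i, φ (X i) = ψ (X i)) : φ = ψ := by
  have hp : φ.comp (ofPoly k α) = ψ.comp (ofPoly k α) :=
    FreeAlgebra.hom_ext (funext fun i => by simpa using h i)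
  refine AlgHom.ext fun f => ?_
  have ha := agree_ofPoly_trunc (max m n) f
  rw [← hφ _ _ (ha.mono (le_max_left m n)), ← hψ _ _ (ha.mono (le_max_right m n))]
  exact DFunLike.congr_fun hp _

/-- Both sides are multiplicative and agree on the generators, hence on the abstract free group;
both are locally constant in `f`, so density finishes. -/
theorem evalQuot_magnus [IsTopologicalGroup G] (U : OpenNormalSubgroup G) (f : FreeProP p d) :
    evalQuot hc hs U (FreeProP.magnus p d f) =
      MonoidAlgebra.of (ZMod p) (G ⧸ U.toSubgroup) (π f) := by
  have hfree : ∀ h : FreeGroup (Fin d),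
      evalQuot hc hs U (FreeProP.magnus p d (FreeProP.ofFree p d h)) =
        MonoidAlgebra.of (ZMod p) (G ⧸ U.toSubgroup) (π (FreeProP.ofFree p d h)) := by
    have he : (((evalQuot hc hs U : _ →* _).comp (FreeProP.magnus p d)).comp
          (FreeProP.ofFree p d)).toHomUnits =
        ((MonoidAlgebra.of (ZMod p) (G ⧸ U.toSubgroup)).comp
          ((QuotientGroup.mk' U.toSubgroup).comp (π.comp (FreeProP.ofFree p d)))).toHomUnits := by
      refine FreeGroup.ext_hom _ _ fun i => Units.ext ?_
      change evalQuot hc hs U (FreeProP.magnus p d (FreeProP.x i)) = _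
      rw [FreeProP.magnus_x, map_add, map_one, evalQuot_X, add_sub_cancel]
      rfl
    intro h
    exact congrArg Units.val (DFunLike.congr_fun he h)
  set L := FreeProP.level p d (evalLevel hc hs U)
  -- An element of the abstract free group with the same Magnus series up to the evaluation level
  -- and the same class modulo `U`.
  obtain ⟨h, h1, h2⟩ := FreeProP.exists_ofFree_mem (f := f)
    (V := {g | g.1 L = f.1 L} ∩ {g | (π f)⁻¹ * π g ∈ U.toSubgroup})
    (by
      refine IsOpen.inter ?_ ?_
      · exact (isOpen_discrete {f.1 L}).preimage (proPCompletion.continuous_eval L)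
      · exact U.toOpenSubgroup.isOpen.preimage (continuous_const.mul hc))
    ⟨rfl, by
      change (π f)⁻¹ * π f ∈ U.toSubgroup
      rw [inv_mul_cancel]
      exact one_mem _⟩
  rw [← evalQuot_congr hc hs U (FreeProP.agree_magnus h1), hfree]
  exact congrArg _ (QuotientGroup.eq.mpr h2).symm

/-- The homomorphism from series to the completed group algebra with `X_i ↦ x_i - 1`. -/
noncomputable def evalGroup :
    NCSeries (ZMod p) (Fin d) →ₐ[ZMod p] completedGroupAlgebra p G :=
  AlgHom.codRestrict (AlgHom.pi (R := ZMod p) (evalQuot hc hs)) (completedGroupAlgebra p G)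
    (fun f U V h => by
      have he : (MonoidAlgebra.mapDomainAlgHom (ZMod p) (ZMod p)
          (QuotientGroup.map U.toSubgroup V.toSubgroup (MonoidHom.id G) h)).comp
            (evalQuot hc hs U) = evalQuot hc hs V := by
        refine NCSeries.hom_ext_of_agree (fun f g h => by
          rw [AlgHom.comp_apply, AlgHom.comp_apply, evalQuot_congr hc hs U h])
          (fun f g h => evalQuot_congr hc hs V h) fun i => ?_
        rw [AlgHom.comp_apply, evalQuot_X, evalQuot_X, map_sub, map_one]
        simp only [MonoidAlgebra.of_apply, MonoidAlgebra.mapDomainAlgHom_apply,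
          MonoidAlgebra.mapDomain_single]
        rfl
      exact DFunLike.congr_fun he f)

theorem evalGroup_apply (f : NCSeries (ZMod p) (Fin d)) (U : OpenNormalSubgroup G) :
    (evalGroup hc hs f).1 U = evalQuot hc hs U f := rfl

theorem evalGroup_X (i : Fin d) :
    evalGroup hc hs (X i) = groupElt p (π (FreeProP.x i)) - 1 :=
  Subtype.ext (funext fun U => evalQuot_X hc hs U i)

theorem groupAug_evalGroup (f : NCSeries (ZMod p) (Fin d)) :
    groupAug p G (evalGroup hc hs f) = aug (ZMod p) (Fin d) f := by
  have h : (groupAug p G).comp (evalGroup hc hs) = aug (ZMod p) (Fin d) := by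
    refine NCSeries.hom_ext_of_agree (m := evalLevel hc hs (wholeGroup G)) (n := 1)
      (fun f g h => ?_) (fun f g h => h [] (by simp)) fun i => ?_
    · exact congrArg (MonoidAlgebra.lift (ZMod p) (ZMod p) (G ⧸ (wholeGroup G).toSubgroup) 1)
        (evalQuot_congr hc hs (wholeGroup G) h)
    · rw [AlgHom.comp_apply, evalGroup_X, map_sub, map_one, groupAug_groupElt, sub_self]
      exact (X_nil i).symm
  exact DFunLike.congr_fun h f

instance : CompactSpace (NCSeries (ZMod p) (Fin d)) := by
  let _ : TopologicalSpace (ZMod p) := ⊥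
  exact inferInstanceAs (CompactSpace (List (Fin d) → ZMod p))

theorem evalQuot_surjective [IsTopologicalGroup G] (U : OpenNormalSubgroup G) :
    Function.Surjective (evalQuot hc hs U) := by
  intro a
  induction a using MonoidAlgebra.induction_on with
  | of q =>
    obtain ⟨g, rfl⟩ := QuotientGroup.mk_surjective q
    obtain ⟨f, rfl⟩ := hs g
    exact ⟨_, evalQuot_magnus hc hs U f⟩
  | add a b ha hb =>
    obtain ⟨f, rfl⟩ := ha
    obtain ⟨g, rfl⟩ := hb
    exact ⟨f + g, map_add _ _ _⟩
  | smul r a ha =>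
    obtain ⟨f, rfl⟩ := ha
    exact ⟨r • f, map_smul _ _ _⟩

/-- At each finite level preimages form a nonempty closed subset of the compact space of series.
These subsets are directed, since `U ⊓ V` refines `U` and `V`, so they have a common point. -/
theorem evalGroup_surjective [IsTopologicalGroup G] : Function.Surjective (evalGroup hc hs) := by
  intro e
  have : Nonempty (OpenNormalSubgroup G) := ⟨wholeGroup G⟩
  have hclosed : ∀ U : OpenNormalSubgroup G, IsClosed {f | evalQuot hc hs U f = e.1 U} := by
    intro U
    rw [← closure_subset_iff_isClosed]
    intro f hf
    obtain ⟨s, hs', hsf⟩ := mem_closure_iff_agree.mp hf (evalLevel hc hs U)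
    exact (evalQuot_congr hc hs U hsf).symm.trans hs'
  obtain ⟨f, hf⟩ := IsCompact.nonempty_iInter_of_directed_nonempty_isCompact_isClosed
    (fun U : OpenNormalSubgroup G => {f | evalQuot hc hs U f = e.1 U})
    (fun U V => by
      refine ⟨U ⊓ V, fun f hf => ?_, fun f hf => ?_⟩
      · have hle : (U ⊓ V).toSubgroup ≤ U.toSubgroup := fun g hg => hg.1
        change evalQuot hc hs (U ⊓ V) f = e.1 (U ⊓ V) at hf
        change evalQuot hc hs U f = e.1 U
        rw [← e.2 _ _ hle, ← hf]
        exact ((evalGroup hc hs f).2 _ _ hle).symm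
      · have hle : (U ⊓ V).toSubgroup ≤ V.toSubgroup := fun g hg => hg.2
        change evalQuot hc hs (U ⊓ V) f = e.1 (U ⊓ V) at hf
        change evalQuot hc hs V f = e.1 V
        rw [← e.2 _ _ hle, ← hf]
        exact ((evalGroup hc hs f).2 _ _ hle).symm)
    (fun U => evalQuot_surjective hc hs U (e.1 U))
    (fun U => (hclosed U).isCompact) hclosed
  exact ⟨f, Subtype.ext (funext fun U => Set.mem_iInter.mp hf U)⟩

end MagnusGroupAlgebra

/-! ### The kernel of this map is the closed ideal of the relators -/

section Kernel

open NCSeries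

variable {p d : ℕ} [Fact p.Prime] {G : Type*} [Group G] [TopologicalSpace G]
  {π : FreeProP p d →* G} {ι : Type*} {l : ι → FreeProP p d}

theorem evalGroup_eq_zero_of_mem [IsTopologicalGroup G] (hπ : IsProPPresentation π l)
    {f : NCSeries (ZMod p) (Fin d)} (hf : f ∈ relIdeal l) :
    evalGroup hπ.continuous hπ.surjective f = 0 := by
  refine Subtype.ext (funext fun U => ?_)
  have hle : TwoSidedIdeal.span (Set.range fun i => relSeries (l i)) ≤
      TwoSidedIdeal.ker (evalQuot hπ.continuous hπ.surjective U) := by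
    rw [TwoSidedIdeal.span_le]
    rintro _ ⟨i, rfl⟩
    have hi : l i ∈ (π.ker : Set (FreeProP p d)) := by
      rw [hπ.ker_eq]
      exact subset_closure (Subgroup.subset_normalClosure ⟨i, rfl⟩)
    rw [SetLike.mem_coe, TwoSidedIdeal.mem_ker]
    change evalQuot _ _ U (FreeProP.magnus p d (l i) - 1) = 0
    rw [map_sub, map_one, evalQuot_magnus,
      MonoidHom.mem_ker.mp hi]
    exact sub_eq_zero.mpr (map_one (MonoidAlgebra.of (ZMod p) (G ⧸ U.toSubgroup)))
  obtain ⟨s, hs, hsf⟩ := mem_closure_iff_agree.mp hf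
    (evalLevel hπ.continuous hπ.surjective U)
  rw [evalGroup_apply, ← evalQuot_congr _ _ U hsf]
  exact (TwoSidedIdeal.mem_ker _).mp (hle hs)

/-- The series that agree up to degree `n` with an element of `I`. -/
def levelIdeal {k α : Type*} [CommRing k] (I : TwoSidedIdeal (NCSeries k α)) (n : ℕ) :
    TwoSidedIdeal (NCSeries k α) :=
  TwoSidedIdeal.mk' {f | ∃ s ∈ I, Agree n s f} ⟨0, I.zero_mem, Agree.refl n 0⟩
    (by
      rintro x y ⟨s, hs, hsx⟩ ⟨t, ht, hty⟩
      exact ⟨s + t, I.add_mem hs ht, hsx.add hty⟩)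
    (by
      rintro x ⟨s, hs, hsx⟩
      refine ⟨-s, I.neg_mem hs, fun w hw => ?_⟩
      rw [NCSeries.neg_apply, NCSeries.neg_apply, hsx w hw])
    (by
      rintro x y ⟨s, hs, hsy⟩
      exact ⟨x * s, I.mul_mem_left _ _ hs, (Agree.refl n x).mul hsy⟩)
    (by
      rintro x y ⟨s, hs, hsx⟩
      exact ⟨s * y, I.mul_mem_right _ _ hs, hsx.mul (Agree.refl n y)⟩)

theorem mem_levelIdeal {k α : Type*} [CommRing k] {I : TwoSidedIdeal (NCSeries k α)} {n : ℕ}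
    {f : NCSeries k α} : f ∈ levelIdeal I n ↔ ∃ s ∈ I, Agree n s f :=
  TwoSidedIdeal.mem_mk' _ _ _ _ _ _ _

/-- Modulo `J`, the ideal `I` enlarged by all series of order at least `n`, the Magnus map kills the
relators and is locally constant. It therefore factors through `G / U` for some open normal `U`, and
`E → E / J` factors through `𝔽_p[G / U]`. A series that dies in `E(G)` thus lies in every `J`, hence
in the closure. -/
theorem mem_of_evalGroup_eq_zero [IsTopologicalGroup G] [T2Space G] (hπ : IsProPPresentation π l)
    {f : NCSeries (ZMod p) (Fin d)} (hf : evalGroup hπ.continuous hπ.surjective f = 0) :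
    f ∈ relIdeal l := by
  refine mem_closure_iff_agree.mpr fun n => ?_
  set J := levelIdeal (TwoSidedIdeal.span (Set.range fun i => relSeries (l i))) n with hJ
  have hJn : ∀ {g h : NCSeries (ZMod p) (Fin d)}, Agree n g h → g - h ∈ J := fun {g h} hgh =>
    mem_levelIdeal.mpr ⟨0, TwoSidedIdeal.zero_mem _, (agree_sub_zero.mpr hgh).symm⟩
  set m := J.ringCon.mkₐ (ZMod p) with hm
  have hmk : ∀ {g h}, m g = m h ↔ g - h ∈ J := fun {g h} => by
    rw [hm, RingCon.mkₐ_apply, RingCon.mkₐ_apply, RingCon.eq, TwoSidedIdeal.rel_iff]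
  let Ψ : FreeProP p d →* (J.ringCon.Quotient)ˣ :=
    ((m : _ →* _).comp (FreeProP.magnus p d)).toHomUnits
  have hΨ : ∀ g, (Ψ g : J.ringCon.Quotient) = m (FreeProP.magnus p d g) := fun _ => rfl
  have hopen : IsOpen (Ψ.ker : Set (FreeProP p d)) := by
    refine isOpen_iff_mem_nhds.mpr fun g hg => ?_
    have ho : IsOpen {h : FreeProP p d | h.1 (FreeProP.level p d n) = g.1 (FreeProP.level p d n)} :=
      (isOpen_discrete {g.1 (FreeProP.level p d n)}).preimage (proPCompletion.continuous_eval _)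
    refine Filter.mem_of_superset (ho.mem_nhds rfl) fun h hh => ?_
    refine (Units.ext ?_ : Ψ h = Ψ g).trans hg
    exact hmk.mpr (hJn (FreeProP.agree_magnus hh))
  have hle : π.ker ≤ Ψ.ker := by
    intro g hg
    have hg' : g ∈ (π.ker : Set (FreeProP p d)) := hg
    rw [hπ.ker_eq] at hg'
    refine closure_minimal ?_ (Subgroup.isClosed_of_isOpen _ hopen) hg'
    refine Subgroup.normalClosure_le_normal ?_
    rintro _ ⟨i, rfl⟩
    refine MonoidHom.mem_ker.mpr (Units.ext ?_)
    rw [hΨ, Units.val_one, ← map_one m, hmk]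
    exact mem_levelIdeal.mpr ⟨_, TwoSidedIdeal.subset_span ⟨i, rfl⟩, Agree.refl n _⟩
  let χ : G →* (J.ringCon.Quotient)ˣ := π.liftOfSurjective hπ.surjective ⟨Ψ, hle⟩
  have hχ : ∀ g, χ (π g) = Ψ g := fun g =>
    MonoidHom.liftOfRightInverse_comp_apply _ _ _ ⟨Ψ, hle⟩ g
  -- A continuous surjection from a compact space to a Hausdorff space is a quotient map, so
  -- openness of `χ.ker` can be tested on its preimage `Ψ.ker`.
  have hq : Topology.IsQuotientMap π :=
    hπ.continuous.isClosedMap.isQuotientMap hπ.continuous hπ.surjective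
  let U : OpenNormalSubgroup G :=
    { toSubgroup := χ.ker
      isOpen' := by
        refine hq.isOpen_preimage.mp ?_
        convert hopen using 1
        ext g
        exact (MonoidHom.mem_ker.trans (by rw [hχ])).trans MonoidHom.mem_ker.symm
      isNormal' := inferInstance }
  let μ : MonoidAlgebra (ZMod p) (G ⧸ U.toSubgroup) →ₐ[ZMod p] J.ringCon.Quotient :=
    MonoidAlgebra.lift (ZMod p) _ _ ((Units.coeHom _).comp (QuotientGroup.kerLift χ))
  have hμ : μ.comp (evalQuot hπ.continuous hπ.surjective U) = m := by
    refine NCSeries.hom_ext_of_agree (n := n) (fun g h hgh => by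
        rw [AlgHom.comp_apply, AlgHom.comp_apply, evalQuot_congr _ _ U hgh])
      (fun g h hgh => hmk.mpr (hJn hgh)) fun i => ?_
    rw [AlgHom.comp_apply, evalQuot_X, map_sub, map_one, MonoidAlgebra.lift_of, sub_eq_iff_eq_add]
    change (χ (π (FreeProP.x i)) : J.ringCon.Quotient) = _
    rw [hχ, hΨ, FreeProP.magnus_x, map_add, map_one, add_comm]
  have h0 : m f = m 0 := by
    rw [map_zero, ← hμ, AlgHom.comp_apply, ← evalGroup_apply, hf]
    exact map_zero μ
  rw [hmk, sub_zero] at h0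
  exact mem_levelIdeal.mp h0

end Kernel

/-! ### Homogeneous components of series -/

namespace NCSeries

variable {k α : Type*} [CommRing k]

variable (k α) in
/-- The homogeneous component of degree `n` of a series. -/
def homogeneous (n : ℕ) : NCSeries k α →ₗ[k] NCSeries k α where
  toFun f := fun w => if w.length = n then f w else 0
  map_add' f g := by
    funext w
    change (if w.length = n then f w + g w else 0) =
      (if w.length = n then f w else 0) + (if w.length = n then g w else 0)
    split_ifs <;> simp
  map_smul' c f := by
    funext w
    change (if w.length = n then c * f w else 0) = c * (if w.length = n then f w else 0)
    split_ifs <;> simp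

theorem homogeneous_apply (n : ℕ) (f : NCSeries k α) (w : List α) :
    homogeneous k α n f w = if w.length = n then f w else 0 := rfl

theorem agree_homogeneous (n : ℕ) (f : NCSeries k α) : Agree n (homogeneous k α n f) 0 :=
  fun w hw => by rw [homogeneous_apply, if_neg hw.ne, zero_apply]

theorem agree_succ_homogeneous {n : ℕ} {f : NCSeries k α} (hf : Agree n f 0) :
    Agree (n + 1) (homogeneous k α n f) f := fun w hw => by
  rw [homogeneous_apply]
  rcases Nat.lt_succ_iff_lt_or_eq.mp hw with h | h
  · rw [if_neg h.ne, hf w h, zero_apply]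
  · rw [if_pos h]

theorem homogeneous_ofPoly_word (n : ℕ) (w : List α) :
    homogeneous k α n (ofPoly k α (word k w)) =
      if w.length = n then ofPoly k α (word k w) else 0 := by
  classical
  funext v
  rw [homogeneous_apply, ofPoly_word]
  by_cases hv : v = w
  · subst hv
    by_cases h : v.length = n
    · rw [if_pos h, if_pos h, ofPoly_word]
    · rw [if_neg h, if_neg h, zero_apply]
  · rw [if_neg hv, ite_self]
    by_cases h : w.length = n
    · rw [if_pos h, ofPoly_word, if_neg hv]
    · rw [if_neg h, zero_apply]

theorem ofPoly_word_mem_augPow (w : List α) :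
    ofPoly k α (word k w) ∈ augPow (aug k α) w.length := by
  induction w with
  | nil => rw [List.length_nil, augPow_zero]; trivial
  | cons a w ih =>
    rw [word_cons, map_mul, ofPoly_ι, List.length_cons, add_comm]
    exact augPow_mul _ (X_mem_augPow a) ih

end NCSeries

/-! ### Graded algebras of augmented algebras under homomorphisms -/

section AugPow

variable {k A B : Type*} [CommRing k] [Ring A] [Algebra k A] [Ring B] [Algebra k B]
  {ε : A →ₐ[k] k} {η : B →ₐ[k] k} {θ : A →ₐ[k] B}

theorem map_mem_augPow (h : ∀ a, η (θ a) = ε a) {n : ℕ} {a : A} (ha : a ∈ augPow ε n) :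
    θ a ∈ augPow η n := by
  induction n generalizing a with
  | zero => rw [augPow_zero]; trivial
  | succ n ih =>
    change a ∈ (RingHom.ker ε ^ (n + 1) : Ideal A) at ha
    rw [Ideal.IsTwoSided.pow_succ] at ha
    refine Submodule.mul_induction_on ha (fun x hx y hy => ?_) (fun x y hx hy => ?_)
    · rw [map_mul, add_comm]
      refine augPow_mul η ?_ (ih hy)
      rw [augPow_one]
      exact (h x).trans hx
    · rw [map_add]
      exact add_mem hx hy

/-- Compatibility of the augmentations puts every preimage of an augmentation element in the
augmentation ideal, so products lift factor by factor. -/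
theorem exists_mem_augPow (h : ∀ a, η (θ a) = ε a) (hs : Function.Surjective θ) {n : ℕ} {b : B}
    (hb : b ∈ augPow η n) : ∃ a ∈ augPow ε n, θ a = b := by
  induction n generalizing b with
  | zero =>
    obtain ⟨a, rfl⟩ := hs b
    exact ⟨a, by rw [augPow_zero]; trivial, rfl⟩
  | succ n ih =>
    change b ∈ (RingHom.ker η ^ (n + 1) : Ideal B) at hb
    rw [Ideal.IsTwoSided.pow_succ] at hb
    refine Submodule.mul_induction_on hb (fun x hx y hy => ?_) (fun x y hx hy => ?_)
    · obtain ⟨a, rfl⟩ := hs x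
      obtain ⟨c, hc, rfl⟩ := ih hy
      refine ⟨a * c, ?_, map_mul _ _ _⟩
      rw [add_comm]
      refine augPow_mul ε ?_ hc
      rw [augPow_one]
      exact (h a).symm.trans hx
    · obtain ⟨a, ha, rfl⟩ := hx
      obtain ⟨c, hc, rfl⟩ := hy
      exact ⟨a + c, add_mem ha hc, map_add _ _ _⟩

theorem GrPart.lof_eq_lof {m n : ℕ} {a : augPow ε m} {b : augPow ε n} (h : m = n)
    (hab : (a : A) = b) :
    DirectSum.lof k ℕ (GrPart ε) m (GrPart.mk a) = DirectSum.lof k ℕ (GrPart ε) n (GrPart.mk b) :=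
  DirectSum.of_eq_of_gradedMonoid_eq (GrPart.sigma_eq h hab)

theorem GrPart.lof_mul_lof {m n : ℕ} (a : augPow ε m) (b : augPow ε n) :
    DirectSum.lof k ℕ (GrPart ε) m (GrPart.mk a) * DirectSum.lof k ℕ (GrPart ε) n (GrPart.mk b) =
      DirectSum.lof k ℕ (GrPart ε) (m + n) (GrPart.mk ⟨a.1 * b.1, augPow_mul ε a.2 b.2⟩) :=
  DirectSum.of_mul_of _ _

theorem GrPart.one_eq_lof : (1 : GradedAlg ε) =
    DirectSum.lof k ℕ (GrPart ε) 0 (GrPart.mk ⟨1, by rw [augPow_zero]; trivial⟩) := rfl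

/-- The map on graded pieces induced by a homomorphism of augmented algebras, on elements. -/
noncomputable def grMk (h : ∀ a, η (θ a) = ε a) (n : ℕ) : augPow ε n →ₗ[k] GrPart η n :=
  GrPart.mk ∘ₗ (θ.toLinearMap.restrict fun _ ha => map_mem_augPow h ha)

theorem grMk_apply (h : ∀ a, η (θ a) = ε a) {n : ℕ} (a : augPow ε n) :
    grMk h n a = GrPart.mk ⟨θ a, map_mem_augPow h a.2⟩ := rfl

end AugPow

/-! ### The graded algebra of a quotient of the algebra of series -/

section GradedSymbols

open NCSeries

variable {k : Type*} [CommRing k] {α : Type*} {B : Type*} [Ring B] [Algebra k B]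
  {η : B →ₐ[k] k} {θ : NCSeries k α →ₐ[k] B}

/-- The class in degree one of the image of a variable. -/
noncomputable def varSymbol (h : ∀ f, η (θ f) = aug k α f) (i : α) : GradedAlg η :=
  DirectSum.lof k ℕ (GrPart η) 1 (grMk h 1 ⟨X i, X_mem_augPow i⟩)

theorem lift_varSymbol_word (h : ∀ f, η (θ f) = aug k α f) (w : List α) :
    FreeAlgebra.lift k (varSymbol h) (word k w) = DirectSum.lof k ℕ (GrPart η) w.length
      (grMk h w.length ⟨ofPoly k α (word k w), ofPoly_word_mem_augPow w⟩) := by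
  induction w with
  | nil =>
    refine (map_one (FreeAlgebra.lift k (varSymbol h))).trans ?_
    rw [GrPart.one_eq_lof]
    refine GrPart.lof_eq_lof rfl ?_
    change (1 : B) = θ (ofPoly k α 1)
    rw [map_one, map_one]
  | cons a w ih =>
    have e : FreeAlgebra.lift k (varSymbol h) (word k (a :: w)) =
        varSymbol h a * FreeAlgebra.lift k (varSymbol h) (word k w) := by
      rw [word_cons, map_mul, FreeAlgebra.lift_ι_apply]
    rw [e, ih, varSymbol, grMk_apply, grMk_apply, GrPart.lof_mul_lof]
    refine GrPart.lof_eq_lof (add_comm _ _) ?_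
    simp only [word_cons, map_mul, ofPoly_ι]
    exact (map_mul θ _ _).symm

variable [Finite α]

theorem component_lift_varSymbol (h : ∀ f, η (θ f) = aug k α f) (q : FreeAlgebra k α) (n : ℕ) :
    (FreeAlgebra.lift k (varSymbol h) q : GradedAlg η) n =
      grMk h n ⟨homogeneous k α n (ofPoly k α q), mem_augPow_iff.mpr (agree_homogeneous n _)⟩ := by
  have hlin : DirectSum.component k ℕ (GrPart η) n ∘ₗ (FreeAlgebra.lift k (varSymbol h)).toLinearMap =
      grMk h n ∘ₗ (homogeneous k α n ∘ₗ (ofPoly k α).toLinearMap).codRestrict _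
        (fun q => mem_augPow_iff.mpr (agree_homogeneous n _)) := by
    refine LinearMap.ext_on_range span_word fun w => ?_
    change DirectSum.component k ℕ (GrPart η) n (FreeAlgebra.lift k (varSymbol h) (word k w)) =
      grMk h n ⟨homogeneous k α n (ofPoly k α (word k w)), _⟩
    rw [lift_varSymbol_word]
    by_cases hw : w.length = n
    · subst hw
      rw [DirectSum.component.lof_self]
      congr 2
      rw [homogeneous_ofPoly_word, if_pos rfl]
    · rw [DirectSum.component.of, dif_neg hw]
      have : (⟨homogeneous k α n (ofPoly k α (word k w)),
          mem_augPow_iff.mpr (agree_homogeneous n _)⟩ : augPow (aug k α) n) = 0 :=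
        Subtype.ext ((homogeneous_ofPoly_word n w).trans (if_neg hw))
      rw [this, map_zero]
  exact DFunLike.congr_fun hlin q

/-- The component `q_n` dies in the graded algebra when `θ q_n = θ g` for some `g` of order above
`n`; then `q_n - g` is an element of the kernel with initial part `q_n`. So the relations among the
symbols are the initial forms of `ker θ`. -/
theorem lift_varSymbol_eq_zero (h : ∀ f, η (θ f) = aug k α f) (hs : Function.Surjective θ)
    {q : FreeAlgebra k α} : FreeAlgebra.lift k (varSymbol h) q = 0 ↔
      ∀ n, ∃ f, θ f = 0 ∧ Agree n f 0 ∧ ∀ w : List α, w.length = n → f w = ofPoly k α q w := by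
  have h0 : FreeAlgebra.lift k (varSymbol h) q = 0 ↔
      ∀ n, θ (homogeneous k α n (ofPoly k α q)) ∈ augPow η (n + 1) := by
    rw [DFinsupp.ext_iff]
    refine forall_congr' fun n => ?_
    rw [component_lift_varSymbol, grMk_apply, DirectSum.zero_apply, ← map_zero GrPart.mk,
      GrPart.mk_eq_mk]
    simp
  rw [h0]
  refine forall_congr' fun n => ⟨fun hn => ?_, ?_⟩
  · obtain ⟨g, hg, hgq⟩ := exists_mem_augPow h hs hn
    have hg' := agree_of_mem_augPow hg
    refine ⟨homogeneous k α n (ofPoly k α q) - g, by rw [map_sub, hgq, sub_self], ?_, ?_⟩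
    · exact agree_sub_zero.mpr ((agree_homogeneous n _).trans (hg'.mono (Nat.le_succ n)).symm)
    · intro w hw
      rw [NCSeries.sub_apply, hg' w (by omega), homogeneous_apply, if_pos hw,
        NCSeries.zero_apply, sub_zero]
  · rintro ⟨f, hf, hf0, hfq⟩
    have hmem : homogeneous k α n (ofPoly k α q) - f ∈ augPow (aug k α) (n + 1) := by
      refine mem_augPow_iff.mpr (agree_sub_zero.mpr ?_)
      refine Agree.trans (fun w hw => ?_) (agree_succ_homogeneous hf0)
      rw [homogeneous_apply, homogeneous_apply]
      split_ifs with hn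
      · exact (hfq w hn).symm
      · rfl
    have := map_mem_augPow h hmem
    rwa [map_sub, hf, sub_zero] at this

/-- A class of degree `n` lifts to a series of order at least `n`, and only its finitely many words
of length `n` matter. This yields both gradedness and surjectivity in the theorem. -/
theorem span_varSymbol_pow (h : ∀ f, η (θ f) = aug k α f) (hs : Function.Surjective θ) (n : ℕ) :
    Submodule.span k (Set.range (varSymbol h)) ^ n =
      LinearMap.range (DirectSum.lof k ℕ (GrPart η) n) := by
  refine le_antisymm ?_ ?_
  · induction n with
    | zero =>
      rw [pow_zero, Submodule.one_le]
      exact ⟨_, rfl⟩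
    | succ n ih =>
      rw [pow_succ]
      refine Submodule.mul_le.mpr fun a ha b hb => ?_
      obtain ⟨a, rfl⟩ := ih ha
      have hle : Submodule.span k (Set.range (varSymbol h)) ≤
          LinearMap.range (DirectSum.lof k ℕ (GrPart η) 1) := by
        rw [Submodule.span_le]
        rintro _ ⟨i, rfl⟩
        exact ⟨_, rfl⟩
      obtain ⟨b, rfl⟩ := hle hb
      exact ⟨_, (DirectSum.of_mul_of a b).symm⟩
  · rintro _ ⟨x, rfl⟩
    obtain ⟨⟨b, hb⟩, rfl⟩ := GrPart.mk_surjective x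
    obtain ⟨f, hf, rfl⟩ := exists_mem_augPow h hs hb
    have hf0 := agree_of_mem_augPow hf
    have hq : FreeAlgebra.lift k (varSymbol h) (trunc k α (n + 1) f) =
        DirectSum.lof k ℕ (GrPart η) n (GrPart.mk ⟨θ f, hb⟩) := by
      refine DFinsupp.ext fun m => ?_
      rw [component_lift_varSymbol]
      by_cases hm : n = m
      · subst hm
        rw [DirectSum.lof_apply, grMk_apply, GrPart.mk_eq_mk, ← map_sub]
        refine map_mem_augPow h (mem_augPow_iff.mpr (agree_sub_zero.mpr ?_))
        refine Agree.trans (fun w hw => ?_) (agree_succ_homogeneous hf0)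
        change homogeneous k α n _ w = _
        rw [homogeneous_apply, homogeneous_apply, ofPoly_trunc, if_pos hw]
      · have : (⟨homogeneous k α m (ofPoly k α (trunc k α (n + 1) f)),
            mem_augPow_iff.mpr (agree_homogeneous m _)⟩ : augPow (aug k α) m) = 0 := by
          refine Subtype.ext (funext fun w => ?_)
          change homogeneous k α m _ w = 0
          rw [homogeneous_apply, ofPoly_trunc]
          split_ifs with h1 h2
          · exact hf0 w (by omega)
          · rfl
          · rfl
        rw [this, map_zero, DirectSum.lof_eq_of, DirectSum.of_eq_of_ne _ _ _ (Ne.symm hm)]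
    rw [← hq, trunc_apply, map_sum]
    refine sum_mem fun w hw => ?_
    rw [map_smul]
    have hw' : w.length < n + 1 := by simpa using hw
    rcases Nat.lt_succ_iff_lt_or_eq.mp hw' with hlt | rfl
    · rw [hf0 w hlt, NCSeries.zero_apply, zero_smul]
      exact zero_mem _
    · refine Submodule.smul_mem _ _ ?_
      rw [lift_word]
      clear * -
      induction w with
      | nil => exact Submodule.one_le.mp le_rfl
      | cons a w ih =>
        rw [List.map_cons, List.prod_cons, List.length_cons, pow_succ']
        exact Submodule.mul_mem_mul (Submodule.subset_span ⟨a, rfl⟩) ih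

end GradedSymbols

theorem mainTheorem2 (p : ℕ) [Fact p.Prime] (d : ℕ) (Γ : SimpleGraph (Fin d))
    (l : Γ.edgeSet → FreeProP p d) (hl : GradCondition Γ l)
    {G : Type*} [Group G] [TopologicalSpace G] [IsTopologicalGroup G] [T2Space G]
    (π : FreeProP p d →* G) (hπ : IsProPPresentation π l) :
    gradIdeal (relIdeal l) = (raaIdeal (ZMod p) Γ : Set (FreeAlgebra (ZMod p) (Fin d))) ∧
    ∃ Φ : RAAAlgebra (ZMod p) Γ ≃ₐ[ZMod p] GradedGroupAlgebra p G,
      (∀ i, Φ (raaX (ZMod p) Γ i) = groupSymbol p (π (FreeProP.x i))) ∧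
      ∀ n, (raaDegree (ZMod p) Γ n).map Φ.toLinearMap =
        LinearMap.range (DirectSum.lof (ZMod p) ℕ (GrPart (groupAug p G)) n) := by
  have hI := gradIdeal_eq hl
  refine ⟨hI, ?_⟩
  have haug := groupAug_evalGroup hπ.continuous hπ.surjective
  have hs := evalGroup_surjective hπ.continuous hπ.surjective
  have hsym : ∀ i, varSymbol haug i = groupSymbol p (π (FreeProP.x i)) := fun i =>
    GrPart.lof_eq_lof rfl (evalGroup_X hπ.continuous hπ.surjective i)
  -- The kernel of `𝓔 → 𝓔(G)` consists of the initial forms of the kernel of `E → E(G)`, which is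
  -- `I`, and `Grad(I) = 𝓘(Γ)`.
  have hker : ∀ q, FreeAlgebra.lift (ZMod p) (varSymbol haug) q = 0 ↔ q ∈ raaIdeal (ZMod p) Γ := by
    intro q
    rw [lift_varSymbol_eq_zero haug hs, ← SetLike.mem_coe, ← hI]
    refine forall_congr' fun n => exists_congr fun f => ?_
    rw [NCSeries.mem_augPow_iff]
    exact and_congr_left' ⟨mem_of_evalGroup_eq_zero hπ, evalGroup_eq_zero_of_mem hπ⟩
  let Φ₀ : RAAAlgebra (ZMod p) Γ →ₐ[ZMod p] GradedGroupAlgebra p G :=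
    raaLift (varSymbol haug) (fun i j hij => by
      have h := (hker _).mpr (TwoSidedIdeal.subset_span ⟨i, j, hij, rfl⟩)
      rwa [map_sub, map_mul, map_mul, FreeAlgebra.lift_ι_apply, FreeAlgebra.lift_ι_apply,
        sub_eq_zero] at h)
  have hX : ∀ i, Φ₀ (raaX (ZMod p) Γ i) = varSymbol haug i := raaLift_raaX _ _
  have hdeg : ∀ n, (raaDegree (ZMod p) Γ n).map Φ₀.toLinearMap =
      LinearMap.range (DirectSum.lof (ZMod p) ℕ (GrPart (groupAug p G)) n) := fun n => by
    rw [raaDegree, Submodule.map_pow, Submodule.map_span, ← Set.range_comp,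
      ← span_varSymbol_pow haug hs]
    congr 3
    exact funext hX
  have hbij : Function.Bijective Φ₀ := by
    constructor
    · rw [injective_iff_map_eq_zero]
      intro a ha
      obtain ⟨q, rfl⟩ := RingCon.mkₐ_surjective (α := ZMod p) (raaIdeal (ZMod p) Γ).ringCon a
      exact mk_raaIdeal_eq_zero.mpr ((hker q).mp ha)
    · intro y
      change y ∈ LinearMap.range Φ₀.toLinearMap
      induction y using DirectSum.induction_on with
      | zero => exact zero_mem _
      | of n x =>
        have h : DirectSum.lof (ZMod p) ℕ (GrPart (groupAug p G)) n x ∈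
            (raaDegree (ZMod p) Γ n).map Φ₀.toLinearMap := by
          rw [hdeg]
          exact ⟨x, rfl⟩
        exact LinearMap.map_le_range h
      | add x y hx hy => exact add_mem hx hy
  exact ⟨AlgEquiv.ofBijective Φ₀ hbij, fun i => (hX i).trans (hsym i), hdeg⟩
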